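/- Let $\mathcal C$ be a monoidal category with unit object $\mathbb 1$ and let $(T,\mu,\eta)$ be a monad on $\mathcal C$ equipped with a comonoidal (oplax monoidal) structure $T_2\colon T(X\otimes Y)\to TX\otimes TY$, $T_0\colon T\mathbb 1\to\mathbb 1$ for which $\mu$ and $\eta$ are comonoidal natural transformations. Suppose: 1. $T$ is a (two-sided) Hopf monad: the fusion operators $T(X\otimes TY)\xrightarrow{T_2}TX\otimes T^2Y\xrightarrow{1\otimes\mu}TX\otimes TY$ and $T(TX\otimes Y)\xrightarrow{T_2}T^2X\otimes TY\xrightarrow{\mu\otimes 1}TX\otimes TY$ are isomorphisms for all $X,Y$; 2. $T$ is of descent type: for every $X$ the diagram $X\xrightarrow{\eta}TX\rightrightarrows T^2X$, with parallel arrows $T\eta$ and $\eta T$, is an equaliser; 3. the free algebra $T\mathbb 1$, with the comonoid structure given by $T_2$ and $T_0$, is a Frobenius monoid in the monoidal category $\mathcal C^T$ of $T$-algebras (where $T(A\otimes B)\xrightarrow{T_2}TA\otimes TB\to A\otimes B$ is the action on a tensor product): writing $d\colon T\mathbb 1\to T\mathbb 1\otimes T\mathbb 1$ for the comultiplication, there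 are $T$-algebra morphisms $u\colon\mathbb 1\to T\mathbb 1$ and $m\colon T\mathbb 1\otimes T\mathbb 1\to T\mathbb 1$ such that $u$ is a two-sided unit for $m$ and $(m\otimes1)(1\otimes d)=d\,m=(1\otimes m)(d\otimes 1)$. Then $T$ is right adjoint to itself. More precisely, there is an adjunction $T\dashv T$ such that, for the comonad structure and the monoidal structure on the right adjoint $T$ that correspond under this adjunction to the monad structure and the comonoidal structure of the left adjoint $T$, the following hold: (a) $T$ is a biHopf monad: $T$ is a Hopf monad and its right adjoint is a Hopf comonad, that is, the counit and the comultiplication $\delta$ of the comonad are monoidal natural transformations, and the cofusion operators $TX\otimes TY\xrightarrow{1\otimes\delta}TX\otimes T^2Y\to T(X\otimes TY)$ and $TX\otimes TY\xrightarrow{\delta\otimes1}T^2X\otimes TY\to T(TX\otimes Y)$ are isomorphisms for all $X,Y$; (b) $T$ is a Frobenius monad: its monad structure and this comonad structure make it a Frobenius monoid in the monoidal category of endofunctors of $\mathcal C$, that is, $T\mu\circ\delta T=\delta\circ\mu=\mu T\circ T\delta$; (c) $T$ is a Frobenius monoidal functor: the monoidal structure $t_2$ and the comonoidal structure $T_2$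 satisfy, up to associativity constraints, $(t_2\otimes1)(1\otimes T_2)=T_2\,t_2\colon TX\otimes T(Y\otimes Z)\to T(X\otimes Y)\otimes TZ$ and $(1\otimes t_2)(T_2\otimes1)=T_2\,t_2\colon T(X\otimes Y)\otimes TZ\to TX\otimes T(Y\otimes Z)$. -/

import Mathlib

open CategoryTheory MonoidalCategory

universe v u v₁ u₁

namespace CategoryTheory

open CategoryTheory.Functor Functor.OplaxMonoidal Functor.LaxMonoidal

section Comonoidal

variable {C : Type u} [Category.{v} C] [MonoidalCategory C]
  {D : Type u₁} [Category.{v₁} D] [MonoidalCategory D]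

/-- A natural transformation between comonoidal (oplax monoidal) functors is comonoidal if it is
compatible with the two comonoidal structures. -/
structure NatTrans.IsComonoidal {F G : C ⥤ D} [F.OplaxMonoidal] [G.OplaxMonoidal]
    (τ : F ⟶ G) : Prop where
  counit : τ.app (𝟙_ C) ≫ η G = η F
  tensor (X Y : C) : τ.app (X ⊗ Y) ≫ δ G X Y = δ F X Y ≫ (τ.app X ⊗ₘ τ.app Y)

/-- A Frobenius monoidal functor: a monoidal structure (`ε`, `μ`) and a comonoidal structure
(`η`, `δ`) on `F`, subject to the two Frobenius compatibility conditions. -/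
structure Functor.IsFrobeniusMonoidal (F : C ⥤ D) [F.LaxMonoidal] [F.OplaxMonoidal] :
    Prop where
  frobenius_left (X Y Z : C) :
    F.obj X ◁ δ F Y Z ≫ (α_ (F.obj X) (F.obj Y) (F.obj Z)).inv ≫ μ F X Y ▷ F.obj Z =
      μ F X (Y ⊗ Z) ≫ F.map (α_ X Y Z).inv ≫ δ F (X ⊗ Y) Z
  frobenius_right (X Y Z : C) :
    δ F X Y ▷ F.obj Z ≫ (α_ (F.obj X) (F.obj Y) (F.obj Z)).hom ≫ F.obj X ◁ μ F Y Z =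
      μ F (X ⊗ Y) Z ≫ F.map (α_ X Y Z).hom ≫ δ F X (Y ⊗ Z)

open ComonObj in
/-- The comonoid `A`, with the morphisms `u : 𝟙 ⟶ A` and `m : A ⊗ A ⟶ A`, is a Frobenius
monoid: `u` is a two-sided unit for `m`, and the Frobenius laws hold. -/
structure IsFrobeniusMonoid (A : D) [ComonObj A] (u : 𝟙_ D ⟶ A) (m : A ⊗ A ⟶ A) : Prop where
  one_mul : u ▷ A ≫ m = (λ_ A).hom
  mul_one : A ◁ u ≫ m = (ρ_ A).hom
  frobenius_left : A ◁ Δ[A] ≫ (α_ A A A).inv ≫ m ▷ A = m ≫ Δ[A]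
  frobenius_right : Δ[A] ▷ A ≫ (α_ A A A).hom ≫ A ◁ m = m ≫ Δ[A]

end Comonoidal

namespace Monad

section Monoidal

variable {C : Type u} [Category.{v} C] [MonoidalCategory C]

/-- A comonoidal monad: a comonoidal structure on the functor `T` such that the unit and the
multiplication of the monad are comonoidal natural transformations. -/
class IsComonoidal (T : Monad C) [T.toFunctor.OplaxMonoidal] : Prop where
  unit_isComonoidal : NatTrans.IsComonoidal T.η
  mul_isComonoidal : NatTrans.IsComonoidal T.μ

variable (T : Monad C) [T.toFunctor.OplaxMonoidal]

/-- The left fusion operator `T(X ⊗ TY) ⟶ TX ⊗ TTY ⟶ TX ⊗ TY`. -/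
def leftFusion (X Y : C) : T.obj (X ⊗ T.obj Y) ⟶ T.obj X ⊗ T.obj Y :=
  δ T.toFunctor X (T.obj Y) ≫ T.obj X ◁ T.μ.app Y

/-- The right fusion operator `T(TX ⊗ Y) ⟶ TTX ⊗ TY ⟶ TX ⊗ TY`. -/
def rightFusion (X Y : C) : T.obj (T.obj X ⊗ Y) ⟶ T.obj X ⊗ T.obj Y :=
  δ T.toFunctor (T.obj X) Y ≫ T.μ.app X ▷ T.obj Y

/-- A (two-sided) Hopf monad: a comonoidal monad both of whose fusion operators are invertible. -/
structure IsHopf : Prop extends T.IsComonoidal where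
  isIso_leftFusion (X Y : C) : IsIso (T.leftFusion X Y)
  isIso_rightFusion (X Y : C) : IsIso (T.rightFusion X Y)

variable [T.IsComonoidal]

lemma unit_counit : T.η.app (𝟙_ C) ≫ OplaxMonoidal.η T.toFunctor = 𝟙 _ := by
  simpa using (IsComonoidal.unit_isComonoidal (T := T)).counit

lemma unit_tensor (X Y : C) :
    T.η.app (X ⊗ Y) ≫ δ T.toFunctor X Y = (T.η.app X ⊗ₘ T.η.app Y) := by
  simpa using (IsComonoidal.unit_isComonoidal (T := T)).tensor X Y

lemma mul_counit :
    T.μ.app (𝟙_ C) ≫ OplaxMonoidal.η T.toFunctor = T.map (OplaxMonoidal.η T.toFunctor) ≫ OplaxMonoidal.η T.toFunctor := by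
  simpa using (IsComonoidal.mul_isComonoidal (T := T)).counit

lemma mul_tensor (X Y : C) :
    T.μ.app (X ⊗ Y) ≫ δ T.toFunctor X Y =
      T.map (δ T.toFunctor X Y) ≫ δ T.toFunctor (T.obj X) (T.obj Y) ≫
        (T.μ.app X ⊗ₘ T.μ.app Y) := by
  simpa using (IsComonoidal.mul_isComonoidal (T := T)).tensor X Y

namespace Algebra

variable {T}

/-- The tensor product of two algebras, with action `T(A ⊗ B) ⟶ TA ⊗ TB ⟶ A ⊗ B`. -/
@[simps]
def tensor (A B : T.Algebra) : T.Algebra where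
  A := A.A ⊗ B.A
  a := δ T.toFunctor A.A B.A ≫ (A.a ⊗ₘ B.a)
  unit := by
    rw [← Category.assoc, unit_tensor, tensorHom_comp_tensorHom, A.unit, B.unit]
    exact id_tensorHom_id _ _
  assoc := by
    rw [← Category.assoc, mul_tensor]
    simp only [Category.assoc, tensorHom_comp_tensorHom, A.assoc, B.assoc, Functor.map_comp]
    rw [← tensorHom_comp_tensorHom, δ_natural_assoc]

/-- The tensor product of two morphisms of algebras. -/
@[simps]
def tensorMap {A A' B B' : T.Algebra} (f : A ⟶ A') (g : B ⟶ B') : tensor A B ⟶ tensor A' B' where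
  f := f.f ⊗ₘ g.f
  h := by
    change T.map (f.f ⊗ₘ g.f) ≫ δ T.toFunctor A'.A B'.A ≫ (A'.a ⊗ₘ B'.a) =
      (δ T.toFunctor A.A B.A ≫ (A.a ⊗ₘ B.a)) ≫ (f.f ⊗ₘ g.f)
    rw [← δ_natural_assoc, Category.assoc, tensorHom_comp_tensorHom, tensorHom_comp_tensorHom,
      f.h, g.h]

variable (T) in
/-- The unit object `𝟙`, with action the counit `T𝟙 ⟶ 𝟙`. -/
@[simps]
def unitAlgebra : T.Algebra where
  A := 𝟙_ C
  a := OplaxMonoidal.η T.toFunctor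
  unit := unit_counit T
  assoc := mul_counit T

/-- The monoidal structure on the category of algebras of a comonoidal monad for which the
forgetful functor is strict monoidal. -/
instance : MonoidalCategoryStruct T.Algebra where
  tensorObj := tensor
  tensorHom f g := tensorMap f g
  whiskerLeft A _ _ g :=
    { f := A.A ◁ g.f
      h := by rw [← id_tensorHom]; exact (tensorMap (𝟙 A) g).h }
  whiskerRight f B :=
    { f := f.f ▷ B.A
      h := by rw [← tensorHom_id]; exact (tensorMap f (𝟙 B)).h }
  tensorUnit := unitAlgebra T
  associator A B D := isoMk (α_ A.A B.A D.A) (by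
    change T.map (α_ A.A B.A D.A).hom ≫ δ T.toFunctor A.A (B.A ⊗ D.A) ≫
        (A.a ⊗ₘ (δ T.toFunctor B.A D.A ≫ (B.a ⊗ₘ D.a))) =
      (δ T.toFunctor (A.A ⊗ B.A) D.A ≫ ((δ T.toFunctor A.A B.A ≫ (A.a ⊗ₘ B.a)) ⊗ₘ D.a)) ≫
        (α_ A.A B.A D.A).hom
    have h₁ : (A.a ⊗ₘ (δ T.toFunctor B.A D.A ≫ (B.a ⊗ₘ D.a))) =
        T.obj A.A ◁ δ T.toFunctor B.A D.A ≫ (A.a ⊗ₘ (B.a ⊗ₘ D.a)) := by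
      rw [← id_tensorHom, tensorHom_comp_tensorHom, Category.id_comp]
    have h₂ : ((δ T.toFunctor A.A B.A ≫ (A.a ⊗ₘ B.a)) ⊗ₘ D.a) =
        δ T.toFunctor A.A B.A ▷ T.obj D.A ≫ ((A.a ⊗ₘ B.a) ⊗ₘ D.a) := by
      rw [← tensorHom_id, tensorHom_comp_tensorHom, Category.id_comp]
    rw [h₁, h₂, Category.assoc, Category.assoc, associator_naturality,
      OplaxMonoidal.associativity_assoc])
  leftUnitor A := isoMk (λ_ A.A) (by
    change T.map (λ_ A.A).hom ≫ A.a =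
      (δ T.toFunctor (𝟙_ C) A.A ≫ (OplaxMonoidal.η T.toFunctor ⊗ₘ A.a)) ≫ (λ_ A.A).hom
    rw [δ_comp_η_tensorHom]
    simp)
  rightUnitor A := isoMk (ρ_ A.A) (by
    change T.map (ρ_ A.A).hom ≫ A.a =
      (δ T.toFunctor A.A (𝟙_ C) ≫ (A.a ⊗ₘ OplaxMonoidal.η T.toFunctor)) ≫ (ρ_ A.A).hom
    rw [δ_comp_tensorHom_η]
    simp)

@[simp] lemma tensorObj_A (A B : T.Algebra) : (A ⊗ B).A = A.A ⊗ B.A := rfl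
@[simp] lemma tensorObj_a (A B : T.Algebra) :
    (A ⊗ B).a = δ T.toFunctor A.A B.A ≫ (A.a ⊗ₘ B.a) := rfl
@[simp] lemma tensorUnit_A : (𝟙_ T.Algebra).A = 𝟙_ C := rfl
@[simp] lemma tensorUnit_a : (𝟙_ T.Algebra).a = OplaxMonoidal.η T.toFunctor := rfl
@[simp] lemma tensorHom_f {A A' B B' : T.Algebra} (f : A ⟶ A') (g : B ⟶ B') :
    (f ⊗ₘ g).f = f.f ⊗ₘ g.f := rfl
@[simp] lemma whiskerLeft_f (A : T.Algebra) {B B' : T.Algebra} (g : B ⟶ B') :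
    (A ◁ g).f = A.A ◁ g.f := rfl
@[simp] lemma whiskerRight_f {A A' : T.Algebra} (f : A ⟶ A') (B : T.Algebra) :
    (f ▷ B).f = f.f ▷ B.A := rfl
@[simp] lemma associator_hom_f (A B D : T.Algebra) :
    (α_ A B D).hom.f = (α_ A.A B.A D.A).hom := rfl
@[simp] lemma associator_inv_f (A B D : T.Algebra) :
    (α_ A B D).inv.f = (α_ A.A B.A D.A).inv := rfl
@[simp] lemma leftUnitor_hom_f (A : T.Algebra) : (λ_ A).hom.f = (λ_ A.A).hom := rfl
@[simp] lemma leftUnitor_inv_f (A : T.Algebra) : (λ_ A).inv.f = (λ_ A.A).inv := rfl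
@[simp] lemma rightUnitor_hom_f (A : T.Algebra) : (ρ_ A).hom.f = (ρ_ A.A).hom := rfl
@[simp] lemma rightUnitor_inv_f (A : T.Algebra) : (ρ_ A).inv.f = (ρ_ A.A).inv := rfl

instance : MonoidalCategory T.Algebra where
  tensorHom_def _ _ := by ext; simp [MonoidalCategory.tensorHom_def]
  id_tensorHom_id _ _ := by ext; simp
  tensorHom_comp_tensorHom _ _ _ _ := by ext; simp
  whiskerLeft_id _ _ := by ext; simp
  id_whiskerRight _ _ := by ext; simp
  associator_naturality _ _ _ := by ext; simp
  leftUnitor_naturality _ := by ext; simp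
  rightUnitor_naturality _ := by ext; simp
  pentagon _ _ _ _ := by ext; simp
  triangle _ _ := by ext; simp

end Algebra

/-- The comonoidal structure on the free algebra functor, given by that of `T`. -/
instance : T.free.OplaxMonoidal where
  η := { f := OplaxMonoidal.η T.toFunctor, h := (mul_counit T).symm }
  δ X Y :=
    { f := δ T.toFunctor X Y
      h := (mul_tensor T X Y).symm }
  δ_natural_left f X := Algebra.Hom.ext (δ_natural_left T.toFunctor f X)
  δ_natural_right X f := Algebra.Hom.ext (δ_natural_right T.toFunctor X f)
  oplax_associativity X Y Z := Algebra.Hom.ext (oplax_associativity T.toFunctor X Y Z)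
  oplax_left_unitality X := Algebra.Hom.ext (oplax_left_unitality T.toFunctor X)
  oplax_right_unitality X := Algebra.Hom.ext (oplax_right_unitality T.toFunctor X)

/-- The comonoid structure on the free algebra `T𝟙`, with comultiplication
`T𝟙 ≅ T(𝟙 ⊗ 𝟙) ⟶ T𝟙 ⊗ T𝟙` and counit `T𝟙 ⟶ 𝟙` given by the comonoidal structure of `T`. -/
instance freeUnitComonObj : ComonObj (T.free.obj (𝟙_ C)) :=
  letI := ComonObj.instTensorUnit C
  CategoryTheory.Functor.obj.instComonObj (𝟙_ C) T.free

end Monoidal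

section Plain

variable {C : Type u} [Category.{v} C] (T : Monad C)

/-- A monad is of descent type if `X ⟶ TX ⇉ TTX` (with parallel arrows `Tη` and `ηT`) is an
equaliser for every object `X`. -/
def IsOfDescentType : Prop :=
  ∀ X : C, Nonempty (Limits.IsLimit (Limits.Fork.ofι (f := T.map (T.η.app X))
    (g := T.η.app (T.obj X)) (T.η.app X) (T.η.naturality (T.η.app X)).symm))

lemma conjugate_unit_app {G : C ⥤ C} (adj : T.toFunctor ⊣ G) (X : C) :
    (conjugateEquiv adj Adjunction.id T.η).app X = T.η.app (G.obj X) ≫ adj.counit.app X :=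
  conjugateEquiv_adjunction_id adj T.η X

lemma conjugate_mul_counit {G : C ⥤ C} (adj : T.toFunctor ⊣ G) (X : C) :
    T.map (T.map ((conjugateEquiv adj (adj.comp adj) T.μ).app X)) ≫
        T.map (adj.counit.app (G.obj X)) ≫ adj.counit.app X =
      T.μ.app (G.obj X) ≫ adj.counit.app X := by
  have h := conjugateEquiv_counit adj (adj.comp adj) T.μ X
  rw [Adjunction.comp_counit_app] at h
  exact h

/-- The comonad structure on a right adjoint `G` of a monad `T`: the counit and the
comultiplication are the mates of the unit and the multiplication of `T`. -/
@[simps coe ε δ]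
def adjointComonad {G : C ⥤ C} (adj : T.toFunctor ⊣ G) : Comonad C where
  toFunctor := G
  ε := conjugateEquiv adj Adjunction.id T.η
  δ := conjugateEquiv adj (adj.comp adj) T.μ
  coassoc X := by
    apply (adj.homEquiv _ _).symm.injective
    apply (adj.homEquiv _ _).symm.injective
    apply (adj.homEquiv _ _).symm.injective
    simp only [Adjunction.homEquiv_counit, Functor.map_comp, Category.assoc]
    have hd := T.conjugate_mul_counit adj
    have hm {X Y : C} (f : X ⟶ Y) : T.map (T.map f) ≫ T.μ.app Y = T.μ.app X ≫ T.map f :=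
      T.μ.naturality f
    have hc := adj.counit.naturality ((conjugateEquiv adj (adj.comp adj) T.μ).app X)
    generalize conjugateEquiv adj (adj.comp adj) T.μ = d at hd hc ⊢
    dsimp only [Functor.comp_obj, Functor.id_obj, Functor.comp_map, Functor.id_map] at d hd hc ⊢
    have hc' := congrArg (fun t => T.map (T.map t)) hc
    have hd' := congrArg (fun t => T.map t) (hd (G.obj X))
    simp only [Functor.map_comp] at hc' hd'
    rw [reassoc_of% hc', hd, reassoc_of% hd']
    have hm' := congrArg (fun t => T.map t) (hm (d.app X))
    simp only [Functor.map_comp] at hm'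
    rw [reassoc_of% hm', hd, reassoc_of% (hm (adj.counit.app (G.obj X))),
      reassoc_of% (hm (T.map (d.app X))), hd, ← Category.assoc, ← Category.assoc, T.assoc]
  left_counit X := by
    rw [conjugate_unit_app]
    apply (adj.homEquiv _ _).symm.injective
    have h := T.η.naturality ((conjugateEquiv adj (adj.comp adj) T.μ).app X)
    simp only [Functor.id_map, Functor.id_obj, Functor.comp_obj] at h
    rw [reassoc_of% h]
    simp only [Adjunction.homEquiv_counit, Functor.map_comp, Category.assoc]
    rw [conjugate_mul_counit, ← Category.assoc, T.right_unit]
    simp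
  right_counit X := by
    rw [conjugate_unit_app]
    apply (adj.homEquiv _ _).symm.injective
    have hd := T.conjugate_mul_counit adj X
    have hn := T.η.naturality
      (T.map ((conjugateEquiv adj (adj.comp adj) T.μ).app X) ≫ adj.counit.app (G.obj X))
    have hc := adj.counit.naturality (T.η.app (G.obj X) ≫ adj.counit.app X)
    generalize conjugateEquiv adj (adj.comp adj) T.μ = d at hd hn hc ⊢
    dsimp only [Functor.comp_obj, Functor.id_obj, Functor.comp_map, Functor.id_map] at hd hn hc ⊢
    simp only [Adjunction.homEquiv_counit, Functor.map_comp, Category.assoc] at hd hn hc ⊢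
    rw [hc, reassoc_of% hn, hd, ← Category.assoc, T.left_unit]
    simp

end Plain

end Monad

namespace Comonad

section Monoidal

variable {C : Type u} [Category.{v} C] [MonoidalCategory C] (G : Comonad C)
  [G.toFunctor.LaxMonoidal]

/-- The left cofusion operator `GX ⊗ GY ⟶ GX ⊗ GGY ⟶ G(X ⊗ GY)`. -/
def leftFusion (X Y : C) : G.obj X ⊗ G.obj Y ⟶ G.obj (X ⊗ G.obj Y) :=
  G.obj X ◁ G.δ.app Y ≫ μ G.toFunctor X (G.obj Y)

/-- The right cofusion operator `GX ⊗ GY ⟶ GGX ⊗ GY ⟶ G(GX ⊗ Y)`. -/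
def rightFusion (X Y : C) : G.obj X ⊗ G.obj Y ⟶ G.obj (G.obj X ⊗ Y) :=
  G.δ.app X ▷ G.obj Y ≫ μ G.toFunctor (G.obj X) Y

/-- A (two-sided) Hopf comonad: a monoidal comonad (the counit and the comultiplication are
monoidal natural transformations) both of whose cofusion operators are invertible. -/
structure IsHopf : Prop where
  counit_isMonoidal : NatTrans.IsMonoidal G.ε
  comul_isMonoidal : NatTrans.IsMonoidal G.δ
  isIso_leftFusion (X Y : C) : IsIso (G.leftFusion X Y)
  isIso_rightFusion (X Y : C) : IsIso (G.rightFusion X Y)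

end Monoidal

section Plain

variable {C : Type u} [Category.{v} C]

attribute [local instance] endofunctorMonoidalCategory

/-- A comonad is a comonoid in the monoidal category of endofunctors. -/
@[reducible]
def comonObj (G : Comonad C) : ComonObj G.toFunctor where
  counit := G.ε
  comul := G.δ
  counit_comul := by ext X; simp
  comul_counit := by ext X; simp
  comul_assoc := by ext X; simp

end Plain

end Comonad

namespace Monad

variable {C : Type u} [Category.{v} C] (T : Monad C)

section

attribute [local instance] endofunctorMonoidalCategory

/-- The monad `T`, with the comonoid structure `c` on its underlying endofunctor, is a Frobenius
monad, that is, a Frobenius monoid in the monoidal category of endofunctors. -/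
def IsFrobenius (c : ComonObj T.toFunctor) : Prop :=
  @IsFrobeniusMonoid (C ⥤ C) _ _ T.toFunctor c T.η T.μ

end

/-- `T` is a biHopf monad, by means of the right adjoint `G` of `T`: `T` is a Hopf monad, and `G`
is a Hopf comonad with the comonad structure and the monoidal structure that correspond under
the adjunction to the monad structure and the comonoidal structure of `T`. -/
structure IsBiHopf [MonoidalCategory C] [T.toFunctor.OplaxMonoidal] {G : C ⥤ C}
    (adj : T.toFunctor ⊣ G) : Prop where
  isHopf : T.IsHopf
  adjoint_isHopf : @Comonad.IsHopf C _ _ (T.adjointComonad adj) adj.rightAdjointLaxMonoidal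

end Monad

end CategoryTheory

/-! Let `F ⊣ U` be the free and forgetful functors of the `T`-algebras. The core of the argument is
a second adjunction `U ⊣ F`. Then `T = UF` is right adjoint to itself, and the Frobenius monad laws
are those of an ambidextrous adjunction.

To obtain `U ⊣ F`, consider the comonad `FU` on algebras. The fusion operators of a Hopf monad are
invertible at every algebra (`isIso_fusionLeft`), so `TY ≅ T𝟙 ⊗ Y`, and this is an isomorphism of
comonads (`toUnitTensor_comul`, `toUnitTensor_counit`). Since `T𝟙` is a Frobenius monoid, `FU` is a
Frobenius comonad: it has a unit `w : Y ⟶ TY` and a pairing `k : TTY ⟶ Y`. The pairing turns the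
canonical coaction on a free algebra into a map `TTX ⟶ TX` that respects coactions. Descent makes
`C` a full subcategory of the `FU`-coalgebras, so this map is `T n` for a unique `n : TX ⟶ X`; this
`n` is the counit of `U ⊣ F`, and `w` is its unit (`IsOfDescentType.exists_forgetFreeAdj`).

The mate of `T_2` is `w` at `TX ⊗ TY` followed by `T(n ⊗ n)`. With the adjunction `a` built from `T𝟙
⊗ Y`, the counit of `X ⊗ Y` is computed on `X` alone (`fusionLeft_n`); hence the left cofusion
operator is inverse to the left fusion operator. The Frobenius monoidal laws follow on precomposing
with left fusion.

The right cofusion operator asks for the mirror adjunction `b`, built from `Y ⊗ T𝟙`. Both are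
adjunctions `U ⊣ F`, so they differ by an automorphism of `F` (`compare`), and invertibility passes
from `b` to `a`. -/

namespace CategoryTheory

open CategoryTheory.Functor Functor.OplaxMonoidal Functor.LaxMonoidal

namespace Monad

/-! ### Descent, and adjunctions from the forgetful functor to the free functor -/

section Descent

variable {C : Type u} [Category.{v} C] {T : Monad C}

/-- The component at `X` of the unit of a monad. -/
def one (T : Monad C) (X : C) : X ⟶ T.obj X := T.η.app X

/-- The component at `X` of the multiplication of a monad. -/
def mul (T : Monad C) (X : C) : T.obj (T.obj X) ⟶ T.obj X := T.μ.app X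

lemma one_mul (T : Monad C) (X : C) : T.one (T.obj X) ≫ T.mul X = 𝟙 (T.obj X) := T.left_unit X

lemma map_one_mul (T : Monad C) (X : C) : T.map (T.one X) ≫ T.mul X = 𝟙 (T.obj X) :=
  T.right_unit X

lemma mul_assoc (T : Monad C) (X : C) : T.map (T.mul X) ≫ T.mul X = T.mul (T.obj X) ≫ T.mul X :=
  T.assoc X

lemma one_nat (T : Monad C) {X Y : C} (f : X ⟶ Y) : T.one X ≫ T.map f = f ≫ T.one Y :=
  (T.η.naturality f).symm

lemma mul_nat (T : Monad C) {X Y : C} (f : X ⟶ Y) :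
    T.map (T.map f) ≫ T.mul Y = T.mul X ≫ T.map f :=
  T.μ.naturality f

lemma map_one_nat (T : Monad C) {X Y : C} (f : X ⟶ Y) :
    T.map (T.one X) ≫ T.map (T.map f) = T.map f ≫ T.map (T.one Y) := by
  rw [← T.map_comp, one_nat, T.map_comp]

/-- The morphism `y : TY ⟶ Y` is an action of the monad `T` on `Y`. -/
structure IsAction (T : Monad C) {Y : C} (y : T.obj Y ⟶ Y) : Prop where
  unit : T.one Y ≫ y = 𝟙 Y
  assoc : T.mul Y ≫ y = T.map y ≫ y

lemma isAction_mul (T : Monad C) (X : C) : T.IsAction (T.mul X) :=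
  ⟨T.one_mul X, (T.mul_assoc X).symm⟩

/-- An equaliser is monic, so the unit at `Y` is monic, and its naturality reduces `f = g` to `T f =
T g`. -/
lemma IsOfDescentType.map_injective (hT : T.IsOfDescentType) {X Y : C} {f g : X ⟶ Y}
    (h : T.map f = T.map g) : f = g := by
  obtain ⟨l⟩ := hT Y
  refine Limits.Fork.IsLimit.hom_ext l ?_
  change f ≫ T.one Y = g ≫ T.one Y
  rw [← one_nat, ← one_nat, h]

/-- For a monad of descent type, a morphism of free algebras that commutes with the canonical
coactions is free on a morphism of the base category. -/
lemma IsOfDescentType.exists_map_eq (hT : T.IsOfDescentType) {X Y : C} (f : T.obj X ⟶ T.obj Y)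
    (hf : T.map f ≫ T.mul Y = T.mul X ≫ f)
    (hf' : T.map (T.one X) ≫ T.map f = f ≫ T.map (T.one Y)) :
    ∃ g : X ⟶ Y, T.map g = f := by
  obtain ⟨l⟩ := hT Y
  -- Compatibility with coactions says exactly that the transpose of `f` equalises the pair of the
  -- descent diagram.
  have h : (T.one X ≫ f) ≫ T.map (T.one Y) = (T.one X ≫ f) ≫ T.one (T.obj Y) := by
    rw [Category.assoc, Category.assoc, ← hf', ← one_nat, reassoc_of% (@one_nat _ _ T)]
  obtain ⟨g, hg⟩ : ∃ g : X ⟶ Y, g ≫ T.one Y = T.one X ≫ f :=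
    ⟨Limits.Fork.IsLimit.lift l (T.one X ≫ f) h, Limits.Fork.IsLimit.lift_ι l⟩
  refine ⟨g, ?_⟩
  -- Transposing back: `T` followed by the multiplication recovers an algebra morphism from its
  -- restriction along the unit.
  have hgm := congrArg (fun t => T.map t ≫ T.mul Y) hg
  simp only [T.map_comp, Category.assoc, T.map_one_mul, hf, reassoc_of% T.map_one_mul] at hgm
  simpa using hgm

/-- An adjunction `U ⊣ F` from the forgetful functor of the algebras of `T` to the free algebra
functor, in terms of actions: the unit is `w`, the counit is `n`. -/
structure ForgetFreeAdj (T : Monad C) where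
  /-- The counit `TX ⟶ X`. -/
  n (X : C) : T.obj X ⟶ X
  /-- The unit `Y ⟶ TY` at the algebra `(Y, y)`. -/
  w {Y : C} (y : T.obj Y ⟶ Y) (hy : T.IsAction y) : Y ⟶ T.obj Y
  n_nat {X Y : C} (f : X ⟶ Y) : T.map f ≫ n Y = n X ≫ f
  w_hom {Y : C} (y : T.obj Y ⟶ Y) (hy : T.IsAction y) :
    T.map (w y hy) ≫ T.mul Y = y ≫ w y hy
  w_nat {Y Z : C} (y : T.obj Y ⟶ Y) (hy : T.IsAction y) (z : T.obj Z ⟶ Z) (hz : T.IsAction z)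
    (f : Y ⟶ Z) (hf : T.map f ≫ z = y ≫ f) : w y hy ≫ T.map f = f ≫ w z hz
  w_n {Y : C} (y : T.obj Y ⟶ Y) (hy : T.IsAction y) : w y hy ≫ n Y = 𝟙 Y
  w_map_n (X : C) : w (T.mul X) (T.isAction_mul X) ≫ T.map (n X) = 𝟙 (T.obj X)

/-- If the comonad `FU` on the algebras of a monad of descent type is a Frobenius comonad, by means
of `k` and `w`, then the forgetful functor `U` is left adjoint to the free functor `F`. -/
lemma IsOfDescentType.exists_forgetFreeAdj (hT : T.IsOfDescentType)
    (k : ∀ {Y : C}, (T.obj Y ⟶ Y) → (T.obj (T.obj Y) ⟶ Y))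
    (w : ∀ {Y : C} (y : T.obj Y ⟶ Y), T.IsAction y → (Y ⟶ T.obj Y))
    (k_hom : ∀ {Y : C} (y : T.obj Y ⟶ Y), T.IsAction y →
      T.map (k y) ≫ y = T.mul (T.obj Y) ≫ k y)
    (k_nat : ∀ {Y Z : C} (y : T.obj Y ⟶ Y) (z : T.obj Z ⟶ Z) (f : Y ⟶ Z),
      T.map f ≫ z = y ≫ f → T.map (T.map f) ≫ k z = k y ≫ f)
    (w_hom : ∀ {Y : C} (y : T.obj Y ⟶ Y) (hy : T.IsAction y),
      T.map (w y hy) ≫ T.mul Y = y ≫ w y hy)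
    (w_nat : ∀ {Y Z : C} (y : T.obj Y ⟶ Y) (hy : T.IsAction y) (z : T.obj Z ⟶ Z)
      (hz : T.IsAction z) (f : Y ⟶ Z), T.map f ≫ z = y ≫ f → w y hy ≫ T.map f = f ≫ w z hz)
    (hk : ∀ {Y : C} (y : T.obj Y ⟶ Y), T.IsAction y →
      T.map (T.one (T.obj Y)) ≫ T.map (k y) = T.map (T.map (T.one Y)) ≫ k (T.mul Y))
    (hl : ∀ {Y : C} (y : T.obj Y ⟶ Y), T.IsAction y →
      w (T.mul Y) (T.isAction_mul Y) ≫ k y = y)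
    (hr : ∀ {Y : C} (y : T.obj Y ⟶ Y) (hy : T.IsAction y), T.map (w y hy) ≫ k y = y) :
    ∃ a : T.ForgetFreeAdj, ∀ X : C,
      T.map (a.n X) = T.map (T.map (T.one X)) ≫ k (T.mul X) := by
  have hη (X : C) : T.map (T.map (T.one X)) ≫ T.mul (T.obj X) =
      T.mul X ≫ T.map (T.one X) := mul_nat T _
  -- `T.map (T.one X)` is the coaction of `FU` on the free algebra. Through the pairing it becomes
  -- an action `TTX ⟶ TX`, which respects coactions by `hk` and hence descends.
  have key : ∀ X : C, ∃ g : T.obj X ⟶ X,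
      T.map g = T.map (T.map (T.one X)) ≫ k (T.mul X) := by
    intro X
    apply hT.exists_map_eq
    · rw [T.map_comp, Category.assoc, k_hom _ (T.isAction_mul X), reassoc_of% (@mul_nat _ _ T)]
    · rw [T.map_comp, Category.assoc, ← k_nat _ _ _ (hη X), reassoc_of% (@map_one_nat _ _ T),
        hk _ (T.isAction_mul X), ← T.map_comp_assoc, ← T.map_comp_assoc, ← T.map_comp, ← T.map_comp,
        one_nat]
  choose n hn using key
  refine ⟨⟨n, w, ?_, w_hom, w_nat, ?_, ?_⟩, hn⟩
  · intro X Y f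
    apply hT.map_injective
    rw [T.map_comp, T.map_comp, hn, hn, Category.assoc, ← k_nat _ _ _ (mul_nat T f),
      ← T.map_comp_assoc, ← T.map_comp_assoc, ← map_one_nat]
  · intro Y y hy
    apply hT.map_injective
    rw [T.map_comp, hn, ← hk y hy, ← reassoc_of% (@map_one_nat _ _ T), ← T.map_comp (T.map _), hr,
      ← T.map_comp, hy.unit]
  · intro X
    rw [hn, ← Category.assoc, w_nat _ _ _ (T.isAction_mul _) _ (hη X), Category.assoc,
      hl _ (T.isAction_mul X), T.map_one_mul]

/-! ### Two adjunctions `U ⊣ F` differ by an automorphism of `F` -/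

namespace ForgetFreeAdj

variable (a b : T.ForgetFreeAdj)

/-- The comparison of the right adjoints of two adjunctions between the forgetful functor and the
free functor. -/
def compare (X : C) : T.obj X ⟶ T.obj X := a.w (T.mul X) (T.isAction_mul X) ≫ T.map (b.n X)

lemma compare_hom (X : C) : T.map (compare a b X) ≫ T.mul X = T.mul X ≫ compare a b X := by
  simp only [compare, T.map_comp, Category.assoc]
  rw [mul_nat, ← Category.assoc, a.w_hom, Category.assoc]

lemma compare_nat {X Y : C} (f : X ⟶ Y) : T.map f ≫ compare a b Y = compare a b X ≫ T.map f := by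
  simp only [compare, Category.assoc]
  rw [← T.map_comp, ← b.n_nat, T.map_comp, ← Category.assoc, ← Category.assoc,
    a.w_nat _ _ _ (T.isAction_mul Y) _ (mul_nat T f)]

lemma compare_n (X : C) : compare a b X ≫ a.n X = b.n X := by
  rw [compare, Category.assoc, a.n_nat, ← Category.assoc, a.w_n, Category.id_comp]

lemma w_compare {Y : C} (y : T.obj Y ⟶ Y) (hy : T.IsAction y) :
    b.w y hy ≫ compare a b Y = a.w y hy := by
  rw [compare, ← Category.assoc, ← a.w_nat y hy _ _ _ (b.w_hom y hy), Category.assoc,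
    ← T.map_comp, b.w_n, T.map_id, Category.comp_id]

lemma compare_compare (X : C) : compare a b X ≫ compare b a X = 𝟙 (T.obj X) := by
  rw [compare, compare, ← Category.assoc, Category.assoc (a.w _ _),
    ← b.w_nat _ (T.isAction_mul _) _ (T.isAction_mul X) (T.map (b.n X)) (mul_nat T _),
    Category.assoc, Category.assoc, ← T.map_comp, a.n_nat, ← Category.assoc,
    ← b.w_nat _ (T.isAction_mul X) _ _ _ (a.w_hom _ (T.isAction_mul X)), Category.assoc,
    ← T.map_comp,
    ← Category.assoc (a.w _ _), a.w_n, Category.id_comp, b.w_map_n]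

lemma isIso_compare (X : C) : IsIso (compare a b X) :=
  ⟨compare b a X, compare_compare a b X, compare_compare b a X⟩

end ForgetFreeAdj

end Descent

/-! ### Fusion operators at arbitrary algebras, and the comparisons of `FU` with tensoring by `T𝟙`
-/

section Fusion

variable {C : Type u} [Category.{v} C] [MonoidalCategory C] (T : Monad C)
  [T.toFunctor.OplaxMonoidal]

/-- The fusion operator `T(X ⊗ Y) ⟶ TX ⊗ TY ⟶ TX ⊗ Y` of an object `X` and an action `y` on `Y`. -/
def fusionLeft (X : C) {Y : C} (y : T.obj Y ⟶ Y) : T.obj (X ⊗ Y) ⟶ T.obj X ⊗ Y :=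
  δ T.toFunctor X Y ≫ T.obj X ◁ y

/-- The fusion operator `T(Y ⊗ X) ⟶ TY ⊗ TX ⟶ Y ⊗ TX` of an action `y` on `Y` and an object `X`. -/
def fusionRight {Y : C} (y : T.obj Y ⟶ Y) (X : C) : T.obj (Y ⊗ X) ⟶ Y ⊗ T.obj X :=
  δ T.toFunctor Y X ≫ y ▷ T.obj X

/-- The action on a tensor product. -/
def tensorAction {Y Z : C} (y : T.obj Y ⟶ Y) (z : T.obj Z ⟶ Z) : T.obj (Y ⊗ Z) ⟶ Y ⊗ Z :=
  δ T.toFunctor Y Z ≫ (y ⊗ₘ z)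

/-- The comultiplication of `T𝟙`. -/
def comulUnit : T.obj (𝟙_ C) ⟶ T.obj (𝟙_ C) ⊗ T.obj (𝟙_ C) :=
  T.map (λ_ (𝟙_ C)).inv ≫ δ T.toFunctor (𝟙_ C) (𝟙_ C)

/-- The comparison `TY ⟶ T𝟙 ⊗ Y` for an action `y` on `Y`. -/
def toUnitTensor {Y : C} (y : T.obj Y ⟶ Y) : T.obj Y ⟶ T.obj (𝟙_ C) ⊗ Y :=
  T.map (λ_ Y).inv ≫ T.fusionLeft (𝟙_ C) y

/-- The comparison `TY ⟶ Y ⊗ T𝟙` for an action `y` on `Y`. -/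
def toTensorUnit {Y : C} (y : T.obj Y ⟶ Y) : T.obj Y ⟶ Y ⊗ T.obj (𝟙_ C) :=
  T.map (ρ_ Y).inv ≫ T.fusionRight y (𝟙_ C)

lemma tensorAction_nat {X Y X' Y' : C} {x : T.obj X ⟶ X} {y : T.obj Y ⟶ Y} {x' : T.obj X' ⟶ X'}
    {y' : T.obj Y' ⟶ Y'} {f : X ⟶ X'} {g : Y ⟶ Y'} (hf : T.map f ≫ x' = x ≫ f)
    (hg : T.map g ≫ y' = y ≫ g) :
    T.map (f ⊗ₘ g) ≫ T.tensorAction x' y' = T.tensorAction x y ≫ (f ⊗ₘ g) := by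
  rw [tensorAction, tensorAction, ← δ_natural_assoc, tensorHom_comp_tensorHom, hf, hg,
    Category.assoc, tensorHom_comp_tensorHom]

lemma tensorAction_nat_left {X Y X' : C} {x : T.obj X ⟶ X} {x' : T.obj X' ⟶ X'}
    (y : T.obj Y ⟶ Y) {f : X ⟶ X'} (hf : T.map f ≫ x' = x ≫ f) :
    T.map (f ▷ Y) ≫ T.tensorAction x' y = T.tensorAction x y ≫ f ▷ Y := by
  simpa using T.tensorAction_nat hf (show T.map (𝟙 Y) ≫ y = y ≫ 𝟙 Y by simp)

lemma tensorAction_nat_right {X Y Y' : C} (x : T.obj X ⟶ X) {y : T.obj Y ⟶ Y}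
    {y' : T.obj Y' ⟶ Y'} {f : Y ⟶ Y'} (hf : T.map f ≫ y' = y ≫ f) :
    T.map (X ◁ f) ≫ T.tensorAction x y' = T.tensorAction x y ≫ X ◁ f := by
  simpa using T.tensorAction_nat (show T.map (𝟙 X) ≫ x = x ≫ 𝟙 X by simp) hf

lemma tensorAction_associator {X Y Z : C} (x : T.obj X ⟶ X) (y : T.obj Y ⟶ Y) (z : T.obj Z ⟶ Z) :
    T.map (α_ X Y Z).hom ≫ T.tensorAction x (T.tensorAction y z) =
      T.tensorAction (T.tensorAction x y) z ≫ (α_ X Y Z).hom := by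
  have h₁ : x ⊗ₘ (δ T.toFunctor Y Z ≫ (y ⊗ₘ z)) =
      T.obj X ◁ δ T.toFunctor Y Z ≫ (x ⊗ₘ (y ⊗ₘ z)) := by
    rw [← id_tensorHom, tensorHom_comp_tensorHom, Category.id_comp]
  have h₂ : (δ T.toFunctor X Y ≫ (x ⊗ₘ y)) ⊗ₘ z =
      δ T.toFunctor X Y ▷ T.obj Z ≫ ((x ⊗ₘ y) ⊗ₘ z) := by
    rw [← tensorHom_id, tensorHom_comp_tensorHom, Category.id_comp]
  simp only [tensorAction]
  rw [h₁, h₂, Category.assoc, Category.assoc, associator_naturality,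
      OplaxMonoidal.associativity_assoc]

lemma tensorAction_leftUnitor {X : C} (x : T.obj X ⟶ X) :
    T.map (λ_ X).hom ≫ x = T.tensorAction (OplaxMonoidal.η T.toFunctor) x ≫ (λ_ X).hom := by
  rw [tensorAction, δ_comp_η_tensorHom]
  simp

lemma tensorAction_rightUnitor {X : C} (x : T.obj X ⟶ X) :
    T.map (ρ_ X).hom ≫ x = T.tensorAction x (OplaxMonoidal.η T.toFunctor) ≫ (ρ_ X).hom := by
  rw [tensorAction, δ_comp_tensorHom_η]
  simp

lemma fusionLeft_nat_right (X : C) {Y Z : C} {y : T.obj Y ⟶ Y} {z : T.obj Z ⟶ Z} {f : Y ⟶ Z}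
    (hf : T.map f ≫ z = y ≫ f) :
    T.map (X ◁ f) ≫ T.fusionLeft X z = T.fusionLeft X y ≫ T.obj X ◁ f := by
  simp only [fusionLeft, Category.assoc]
  rw [← δ_natural_right_assoc, ← MonoidalCategory.whiskerLeft_comp, hf,
    MonoidalCategory.whiskerLeft_comp]

lemma fusionLeft_nat_left {X X' : C} (f : X ⟶ X') {Y : C} (y : T.obj Y ⟶ Y) :
    T.map (f ▷ Y) ≫ T.fusionLeft X' y = T.fusionLeft X y ≫ T.map f ▷ Y := by
  simp only [fusionLeft, Category.assoc]
  rw [← δ_natural_left_assoc, whisker_exchange]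

lemma fusionRight_nat_left {Y Z : C} {y : T.obj Y ⟶ Y} {z : T.obj Z ⟶ Z} {f : Y ⟶ Z}
    (hf : T.map f ≫ z = y ≫ f) (X : C) :
    T.map (f ▷ X) ≫ T.fusionRight z X = T.fusionRight y X ≫ f ▷ T.obj X := by
  simp only [fusionRight, Category.assoc]
  rw [← δ_natural_left_assoc, ← comp_whiskerRight, hf, comp_whiskerRight]

lemma fusionRight_nat_right {Y : C} (y : T.obj Y ⟶ Y) {X X' : C} (f : X ⟶ X') :
    T.map (Y ◁ f) ≫ T.fusionRight y X' = T.fusionRight y X ≫ Y ◁ T.map f := by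
  simp only [fusionRight, Category.assoc]
  rw [← δ_natural_right_assoc, whisker_exchange]

lemma map_whiskerLeft_one_fusionLeft (X Y : C) :
    T.map (X ◁ T.one Y) ≫ T.fusionLeft X (T.mul Y) = δ T.toFunctor X Y := by
  rw [fusionLeft, ← δ_natural_right_assoc, ← MonoidalCategory.whiskerLeft_comp, map_one_mul,
    MonoidalCategory.whiskerLeft_id,
    Category.comp_id]

lemma map_one_whiskerRight_fusionRight (X Y : C) :
    T.map (T.one X ▷ Y) ≫ T.fusionRight (T.mul X) Y = δ T.toFunctor X Y := by
  rw [fusionRight, ← δ_natural_left_assoc, ← comp_whiskerRight, map_one_mul, id_whiskerRight,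
    Category.comp_id]

/-- This is coassociativity of `T_2`: fusion with a tensor product of algebras can be done one
factor at a time. -/
lemma fusionLeft_tensorAction (X : C) {Y Z : C} (y : T.obj Y ⟶ Y) (z : T.obj Z ⟶ Z) :
    T.map (α_ X Y Z).hom ≫ T.fusionLeft X (T.tensorAction y z) =
      T.fusionLeft (X ⊗ Y) z ≫ T.fusionLeft X y ▷ Z ≫ (α_ (T.obj X) Y Z).hom := by
  simp only [fusionLeft, tensorAction, MonoidalCategory.whiskerLeft_comp, comp_whiskerRight,
    Category.assoc,
    tensorHom_def']
  rw [← OplaxMonoidal.associativity_assoc, whisker_exchange_assoc]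
  simp

lemma fusionRight_tensorAction {Y Z : C} (y : T.obj Y ⟶ Y) (z : T.obj Z ⟶ Z) (X : C) :
    T.map (α_ Y Z X).inv ≫ T.fusionRight (T.tensorAction y z) X =
      T.fusionRight y (Z ⊗ X) ≫ Y ◁ T.fusionRight z X ≫ (α_ Y Z (T.obj X)).inv := by
  simp only [fusionRight, tensorAction, MonoidalCategory.whiskerLeft_comp, comp_whiskerRight,
    Category.assoc, MonoidalCategory.tensorHom_def]
  rw [← OplaxMonoidal.associativity_inv_assoc, ← whisker_exchange_assoc]
  simp

lemma toUnitTensor_nat {Y Z : C} {y : T.obj Y ⟶ Y} {z : T.obj Z ⟶ Z} {f : Y ⟶ Z}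
    (hf : T.map f ≫ z = y ≫ f) :
    T.map f ≫ T.toUnitTensor z = T.toUnitTensor y ≫ T.obj (𝟙_ C) ◁ f := by
  simp only [toUnitTensor, Category.assoc]
  rw [← T.fusionLeft_nat_right _ hf, ← T.map_comp_assoc, ← T.map_comp_assoc]
  simp

lemma toTensorUnit_nat {Y Z : C} {y : T.obj Y ⟶ Y} {z : T.obj Z ⟶ Z} {f : Y ⟶ Z}
    (hf : T.map f ≫ z = y ≫ f) :
    T.map f ≫ T.toTensorUnit z = T.toTensorUnit y ≫ f ▷ T.obj (𝟙_ C) := by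
  simp only [toTensorUnit, Category.assoc]
  rw [← T.fusionRight_nat_left hf, ← T.map_comp_assoc, ← T.map_comp_assoc]
  simp

lemma toUnitTensor_tensorAction {Y Z : C} (y : T.obj Y ⟶ Y) (z : T.obj Z ⟶ Z) :
    T.toUnitTensor (T.tensorAction y z) =
      T.fusionLeft Y z ≫ T.toUnitTensor y ▷ Z ≫ (α_ (T.obj (𝟙_ C)) Y Z).hom := by
  simp only [toUnitTensor, comp_whiskerRight, Category.assoc]
  rw [← reassoc_of% (@fusionLeft_nat_left _ _ _ T _), ← fusionLeft_tensorAction, ← T.map_comp_assoc]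
  simp

lemma toTensorUnit_tensorAction {Y Z : C} (y : T.obj Y ⟶ Y) (z : T.obj Z ⟶ Z) :
    T.toTensorUnit (T.tensorAction y z) =
      T.fusionRight y Z ≫ Y ◁ T.toTensorUnit z ≫ (α_ Y Z (T.obj (𝟙_ C))).inv := by
  simp only [toTensorUnit, MonoidalCategory.whiskerLeft_comp, Category.assoc]
  rw [← reassoc_of% (@fusionRight_nat_right _ _ _ T _), ← fusionRight_tensorAction,
    ← T.map_comp_assoc]
  simp

lemma toUnitTensor_counit {Y : C} (y : T.obj Y ⟶ Y) :
    T.toUnitTensor y ≫ OplaxMonoidal.η T.toFunctor ▷ Y ≫ (λ_ Y).hom = y := by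
  simp only [toUnitTensor, fusionLeft, Category.assoc]
  rw [whisker_exchange_assoc, leftUnitor_naturality]
  simp

lemma toTensorUnit_counit {Y : C} (y : T.obj Y ⟶ Y) :
    T.toTensorUnit y ≫ Y ◁ OplaxMonoidal.η T.toFunctor ≫ (ρ_ Y).hom = y := by
  simp only [toTensorUnit, fusionRight, Category.assoc]
  rw [← whisker_exchange_assoc, rightUnitor_naturality]
  simp

lemma map_one_toUnitTensor (Y : C) :
    T.map (T.one Y) ≫ T.toUnitTensor (T.mul Y) = T.map (λ_ Y).inv ≫ δ T.toFunctor (𝟙_ C) Y := by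
  rw [← map_whiskerLeft_one_fusionLeft, toUnitTensor, ← T.map_comp_assoc, ← T.map_comp_assoc]
  simp

lemma map_one_toTensorUnit (Y : C) :
    T.map (T.one Y) ≫ T.toTensorUnit (T.mul Y) = T.map (ρ_ Y).inv ≫ δ T.toFunctor Y (𝟙_ C) := by
  rw [← map_one_whiskerRight_fusionRight, toTensorUnit, ← T.map_comp_assoc, ← T.map_comp_assoc]
  simp

/-- The comultiplication of `FU` at `Y` is `T.map (T.one Y)`, so coassociativity of `T_2` makes
`toUnitTensor` respect comultiplications. Together with `toUnitTensor_counit`, it is a morphism of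
comonads from `FU` to `T𝟙 ⊗ -`. -/
lemma toUnitTensor_comul {Y : C} (y : T.obj Y ⟶ Y) :
    T.map (T.one Y) ≫ T.toUnitTensor (T.mul Y) ≫ T.obj (𝟙_ C) ◁ T.toUnitTensor y =
      T.toUnitTensor y ≫ T.comulUnit ▷ Y ≫ (α_ _ _ _).hom := by
  rw [reassoc_of% T.map_one_toUnitTensor]
  simp only [toUnitTensor, fusionLeft, comulUnit, MonoidalCategory.whiskerLeft_comp,
    comp_whiskerRight,
    Category.assoc]
  rw [δ_natural_right_assoc, whisker_exchange_assoc, δ_natural_left_assoc, whisker_exchange_assoc,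
    tensor_whiskerLeft]
  simp only [Category.assoc, Iso.inv_hom_id, Category.comp_id]
  rw [OplaxMonoidal.associativity_assoc, ← T.map_comp_assoc, ← T.map_comp_assoc,
    ← T.map_comp_assoc]
  congr 2
  simp

lemma toTensorUnit_comul {Y : C} (y : T.obj Y ⟶ Y) :
    T.map (T.one Y) ≫ T.toTensorUnit (T.mul Y) ≫ T.toTensorUnit y ▷ T.obj (𝟙_ C) =
      T.toTensorUnit y ≫ Y ◁ T.comulUnit ≫ (α_ _ _ _).inv := by
  rw [reassoc_of% T.map_one_toTensorUnit]
  simp only [toTensorUnit, fusionRight, comulUnit, MonoidalCategory.whiskerLeft_comp,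
    comp_whiskerRight,
    Category.assoc]
  rw [δ_natural_left_assoc, ← whisker_exchange_assoc, δ_natural_right_assoc,
    ← whisker_exchange_assoc, whiskerRight_tensor]
  simp only [Category.assoc, Iso.hom_inv_id, Category.comp_id]
  rw [OplaxMonoidal.associativity_inv_assoc, ← T.map_comp_assoc, ← T.map_comp_assoc,
    ← T.map_comp_assoc]
  congr 2
  simp [unitors_inv_equal]

variable {T}

section

variable [T.IsComonoidal]

lemma isAction_counit : T.IsAction (OplaxMonoidal.η T.toFunctor) :=
  ⟨unit_counit T, mul_counit T⟩

lemma one_tensor (X Y : C) : T.one (X ⊗ Y) ≫ δ T.toFunctor X Y = (T.one X ⊗ₘ T.one Y) :=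
  unit_tensor T X Y

lemma mul_δ (X Y : C) :
    T.mul (X ⊗ Y) ≫ δ T.toFunctor X Y =
      T.map (δ T.toFunctor X Y) ≫ T.tensorAction (T.mul X) (T.mul Y) :=
  mul_tensor T X Y

lemma IsAction.tensor {Y Z : C} {y : T.obj Y ⟶ Y} {z : T.obj Z ⟶ Z} (hy : T.IsAction y)
    (hz : T.IsAction z) : T.IsAction (T.tensorAction y z) where
  unit := by
    rw [tensorAction, reassoc_of% (@one_tensor _ _ _ T _ _), tensorHom_comp_tensorHom, hy.unit,
      hz.unit,
      id_tensorHom_id]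
  assoc := by
    have h := T.tensorAction_nat hy.assoc.symm hz.assoc.symm
    conv_lhs => rw [tensorAction, reassoc_of% (@mul_δ _ _ _ T _ _), ← h]
    rw [← T.map_comp_assoc]
    rfl

lemma one_fusionLeft (X : C) {Y : C} {y : T.obj Y ⟶ Y} (hy : T.IsAction y) :
    T.one (X ⊗ Y) ≫ T.fusionLeft X y = T.one X ▷ Y := by
  rw [fusionLeft, reassoc_of% (@one_tensor _ _ _ T _ _), MonoidalCategory.tensorHom_def,
    Category.assoc, ← MonoidalCategory.whiskerLeft_comp, hy.unit,
    MonoidalCategory.whiskerLeft_id, Category.comp_id]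

lemma one_fusionRight {Y : C} {y : T.obj Y ⟶ Y} (hy : T.IsAction y) (X : C) :
    T.one (Y ⊗ X) ≫ T.fusionRight y X = Y ◁ T.one X := by
  rw [fusionRight, reassoc_of% (@one_tensor _ _ _ T _ _), tensorHom_def', Category.assoc,
    ← comp_whiskerRight, hy.unit,
    id_whiskerRight, Category.comp_id]

/-- Fusion is a morphism of algebras out of the free algebra on `X ⊗ Y`; naturality of `w` can
therefore be applied to it. -/
lemma fusionLeft_hom (X : C) {Y : C} {y : T.obj Y ⟶ Y} (hy : T.IsAction y) :
    T.map (T.fusionLeft X y) ≫ T.tensorAction (T.mul X) y = T.mul (X ⊗ Y) ≫ T.fusionLeft X y := by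
  rw [fusionLeft, reassoc_of% (@mul_δ _ _ _ T _ _), T.map_comp, Category.assoc,
    T.tensorAction_nat_right (T.mul X) hy.assoc.symm]

lemma fusionRight_hom {Y : C} {y : T.obj Y ⟶ Y} (hy : T.IsAction y) (X : C) :
    T.map (T.fusionRight y X) ≫ T.tensorAction y (T.mul X) =
      T.mul (Y ⊗ X) ≫ T.fusionRight y X := by
  rw [fusionRight, reassoc_of% (@mul_δ _ _ _ T _ _), T.map_comp, Category.assoc,
    T.tensorAction_nat_left (T.mul X) hy.assoc.symm]

lemma toUnitTensor_hom {Y : C} {y : T.obj Y ⟶ Y} (hy : T.IsAction y) :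
    T.map (T.toUnitTensor y) ≫ T.tensorAction (T.mul (𝟙_ C)) y = T.mul Y ≫ T.toUnitTensor y := by
  rw [toUnitTensor, T.map_comp, Category.assoc, fusionLeft_hom _ hy, reassoc_of% (@mul_nat _ _ T)]

lemma toTensorUnit_hom {Y : C} {y : T.obj Y ⟶ Y} (hy : T.IsAction y) :
    T.map (T.toTensorUnit y) ≫ T.tensorAction y (T.mul (𝟙_ C)) = T.mul Y ≫ T.toTensorUnit y := by
  rw [toTensorUnit, T.map_comp, Category.assoc, fusionRight_hom hy, reassoc_of% (@mul_nat _ _ T)]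

end

/-- The fusion operators of a Hopf monad are invertible at all algebras, not only at the free
ones. -/
lemma isIso_fusionLeft (h : ∀ X Y : C, IsIso (T.fusionLeft X (T.mul Y))) (X : C) {Y : C}
    {y : T.obj Y ⟶ Y} (hy : T.IsAction y) : IsIso (T.fusionLeft X y) := by
  have h₁ := T.fusionLeft_nat_right X hy.assoc.symm
  have := h X Y
  have := h X (T.obj Y)
  have hz : ∀ z : T.obj (T.obj Y) ⟶ T.obj Y, T.map z ≫ T.mul Y = T.mul (T.obj Y) ≫ z →
      T.obj X ◁ z ≫ inv (T.fusionLeft X (T.mul Y)) =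
        inv (T.fusionLeft X (T.mul (T.obj Y))) ≫ T.map (X ◁ z) := by
    intro z hz
    rw [IsIso.comp_inv_eq, Category.assoc, IsIso.eq_inv_comp, T.fusionLeft_nat_right X hz]
  have hs : T.map (X ◁ T.one Y) ≫ T.map (X ◁ y) = 𝟙 _ := by
    rw [← T.map_comp, ← MonoidalCategory.whiskerLeft_comp, hy.unit, MonoidalCategory.whiskerLeft_id,
      T.map_id]
  have : IsSplitEpi (T.map (X ◁ y)) := ⟨⟨⟨_, hs⟩⟩⟩
  -- An algebra is a coequaliser of free algebras that splits in `C`. The inverse lifts along the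
  -- splitting `T.one Y`, inverts fusion at the free algebra, and projects by `y`; `hz` is
  -- naturality of the inverses at free algebras.
  refine ⟨T.obj X ◁ T.one Y ≫ inv (T.fusionLeft X (T.mul Y)) ≫ T.map (X ◁ y), ?_, ?_⟩
  · rw [← cancel_epi (T.map (X ◁ y)), reassoc_of% h₁, ← MonoidalCategory.whiskerLeft_comp_assoc,
      ← one_nat, MonoidalCategory.whiskerLeft_comp_assoc, reassoc_of% (hz _ (T.mul_nat y)),
      ← T.map_comp, ← MonoidalCategory.whiskerLeft_comp, ← hy.assoc,
      MonoidalCategory.whiskerLeft_comp, T.map_comp, ← reassoc_of% (hz _ (T.mul_assoc Y)),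
      ← MonoidalCategory.whiskerLeft_comp_assoc, one_mul]
    simp
  · rw [Category.assoc, Category.assoc, h₁, IsIso.inv_hom_id_assoc,
      ← MonoidalCategory.whiskerLeft_comp, hy.unit, MonoidalCategory.whiskerLeft_id]

lemma isIso_fusionRight (h : ∀ X Y : C, IsIso (T.fusionRight (T.mul Y) X)) (X : C) {Y : C}
    {y : T.obj Y ⟶ Y} (hy : T.IsAction y) : IsIso (T.fusionRight y X) := by
  have h₁ := T.fusionRight_nat_left hy.assoc.symm X
  have := h X Y
  have := h X (T.obj Y)
  have hz : ∀ z : T.obj (T.obj Y) ⟶ T.obj Y, T.map z ≫ T.mul Y = T.mul (T.obj Y) ≫ z →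
      z ▷ T.obj X ≫ inv (T.fusionRight (T.mul Y) X) =
        inv (T.fusionRight (T.mul (T.obj Y)) X) ≫ T.map (z ▷ X) := by
    intro z hz
    rw [IsIso.comp_inv_eq, Category.assoc, IsIso.eq_inv_comp, T.fusionRight_nat_left hz X]
  have hs : T.map (T.one Y ▷ X) ≫ T.map (y ▷ X) = 𝟙 _ := by
    rw [← T.map_comp, ← comp_whiskerRight, hy.unit, id_whiskerRight, T.map_id]
  have : IsSplitEpi (T.map (y ▷ X)) := ⟨⟨⟨_, hs⟩⟩⟩
  refine ⟨T.one Y ▷ T.obj X ≫ inv (T.fusionRight (T.mul Y) X) ≫ T.map (y ▷ X), ?_, ?_⟩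
  · rw [← cancel_epi (T.map (y ▷ X)), reassoc_of% h₁, ← comp_whiskerRight_assoc,
      ← one_nat, comp_whiskerRight_assoc, reassoc_of% (hz _ (T.mul_nat y)),
      ← T.map_comp, ← comp_whiskerRight, ← hy.assoc,
      comp_whiskerRight, T.map_comp, ← reassoc_of% (hz _ (T.mul_assoc Y)),
      ← comp_whiskerRight_assoc, one_mul]
    simp
  · rw [Category.assoc, Category.assoc, h₁, IsIso.inv_hom_id_assoc,
      ← comp_whiskerRight, hy.unit, id_whiskerRight]

end Fusion

/-! ### Frobenius pairings on `T𝟙` and the adjunctions they give -/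

section Pairing

variable {C : Type u} [Category.{v} C] [MonoidalCategory C] {T : Monad C}
  [T.toFunctor.OplaxMonoidal]

/-- A Frobenius structure on the comonoid `T𝟙` in the category of algebras, in terms of the unit `u`
and the pairing `κ`. -/
structure IsFrobeniusPairing (T : Monad C) [T.toFunctor.OplaxMonoidal] (u : 𝟙_ C ⟶ T.obj (𝟙_ C))
    (κ : T.obj (𝟙_ C) ⊗ T.obj (𝟙_ C) ⟶ 𝟙_ C) : Prop where
  unit_hom : T.map u ≫ T.mul (𝟙_ C) = OplaxMonoidal.η T.toFunctor ≫ u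
  pairing_hom : T.map κ ≫ OplaxMonoidal.η T.toFunctor =
    T.tensorAction (T.mul (𝟙_ C)) (T.mul (𝟙_ C)) ≫ κ
  unit_left : u ▷ T.obj (𝟙_ C) ≫ κ = (λ_ _).hom ≫ OplaxMonoidal.η T.toFunctor
  unit_right : T.obj (𝟙_ C) ◁ u ≫ κ = (ρ_ _).hom ≫ OplaxMonoidal.η T.toFunctor
  -- For the pairing induced by a Frobenius multiplication, both sides are that multiplication.
  comul : T.comulUnit ▷ T.obj (𝟙_ C) ≫ (α_ _ _ _).hom ≫ T.obj (𝟙_ C) ◁ κ ≫ (ρ_ _).hom =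
    T.obj (𝟙_ C) ◁ T.comulUnit ≫ (α_ _ _ _).inv ≫ κ ▷ T.obj (𝟙_ C) ≫ (λ_ _).hom

/-- The pairing `A ⊗ (A ⊗ Y) ⟶ Y`. -/
def contractLeft {A : C} (κ : A ⊗ A ⟶ 𝟙_ C) (Y : C) : A ⊗ (A ⊗ Y) ⟶ Y :=
  (α_ A A Y).inv ≫ κ ▷ Y ≫ (λ_ Y).hom

/-- The pairing `(Y ⊗ A) ⊗ A ⟶ Y`. -/
def contractRight {A : C} (κ : A ⊗ A ⟶ 𝟙_ C) (Y : C) : (Y ⊗ A) ⊗ A ⟶ Y :=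
  (α_ Y A A).hom ≫ Y ◁ κ ≫ (ρ_ Y).hom

lemma contractLeft_nat {A : C} (κ : A ⊗ A ⟶ 𝟙_ C) {Y Z : C} (f : Y ⟶ Z) :
    A ◁ A ◁ f ≫ contractLeft κ Z = contractLeft κ Y ≫ f := by
  simp only [contractLeft, Category.assoc]
  rw [associator_inv_naturality_right_assoc, whisker_exchange_assoc, leftUnitor_naturality]

lemma contractRight_nat {A : C} (κ : A ⊗ A ⟶ 𝟙_ C) {Y Z : C} (f : Y ⟶ Z) :
    f ▷ A ▷ A ≫ contractRight κ Z = contractRight κ Y ≫ f := by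
  simp only [contractRight, Category.assoc]
  rw [associator_naturality_left_assoc, ← whisker_exchange_assoc, rightUnitor_naturality]

lemma contractLeft_tensor {A : C} (κ : A ⊗ A ⟶ 𝟙_ C) (Y Z : C) :
    A ◁ (α_ A Y Z).hom ≫ contractLeft κ (Y ⊗ Z) =
      (α_ A (A ⊗ Y) Z).inv ≫ contractLeft κ Y ▷ Z := by
  simp [contractLeft]

/-- The Frobenius law of `A`, tensored with `Y`, becomes the Frobenius law of the comonad `A ⊗ -`.
-/
lemma comul_contractLeft {A : C} {κ : A ⊗ A ⟶ 𝟙_ C} {d : A ⟶ A ⊗ A}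
    (h : d ▷ A ≫ (α_ _ _ _).hom ≫ A ◁ κ ≫ (ρ_ _).hom =
      A ◁ d ≫ (α_ _ _ _).inv ≫ κ ▷ A ≫ (λ_ _).hom) (Y : C) :
    d ▷ (A ⊗ Y) ≫ (α_ _ _ _).hom ≫ A ◁ contractLeft κ Y =
      A ◁ (d ▷ Y ≫ (α_ _ _ _).hom) ≫ contractLeft κ (A ⊗ Y) := by
  have := congrArg (fun t => (α_ _ _ _).inv ≫ t ▷ Y) h
  simp only [comp_whiskerRight] at this
  simp only [contractLeft]
  calc _ = _ := by simp
    _ = _ := this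
    _ = _ := by simp

lemma comul_contractRight {A : C} {κ : A ⊗ A ⟶ 𝟙_ C} {d : A ⟶ A ⊗ A}
    (h : d ▷ A ≫ (α_ _ _ _).hom ≫ A ◁ κ ≫ (ρ_ _).hom =
      A ◁ d ≫ (α_ _ _ _).inv ≫ κ ▷ A ≫ (λ_ _).hom) (Y : C) :
    (Y ⊗ A) ◁ d ≫ (α_ _ _ _).inv ≫ contractRight κ Y ▷ A =
      (Y ◁ d ≫ (α_ _ _ _).inv) ▷ A ≫ contractRight κ (Y ⊗ A) := by
  have := congrArg (fun t => (α_ _ _ _).hom ≫ Y ◁ t) h.symm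
  simp only [MonoidalCategory.whiskerLeft_comp] at this
  simp only [contractRight]
  calc _ = _ := by simp
    _ = _ := this
    _ = _ := by simp

lemma unit_whiskerRight_contractLeft {A : C} {κ : A ⊗ A ⟶ 𝟙_ C} {u : 𝟙_ C ⟶ A} {e : A ⟶ 𝟙_ C}
    (h : u ▷ A ≫ κ = (λ_ A).hom ≫ e) (Y : C) :
    (λ_ _).inv ≫ u ▷ (A ⊗ Y) ≫ contractLeft κ Y = e ▷ Y ≫ (λ_ Y).hom := by
  have := congrArg (fun t => (λ_ A).inv ▷ Y ≫ t ▷ Y ≫ (λ_ Y).hom) h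
  simpa [contractLeft] using this

lemma whiskerLeft_unit_contractLeft {A : C} {κ : A ⊗ A ⟶ 𝟙_ C} {u : 𝟙_ C ⟶ A} {e : A ⟶ 𝟙_ C}
    (h : A ◁ u ≫ κ = (ρ_ A).hom ≫ e) (Y : C) :
    A ◁ ((λ_ Y).inv ≫ u ▷ Y) ≫ contractLeft κ Y = e ▷ Y ≫ (λ_ Y).hom := by
  have := congrArg (fun t => (ρ_ A).inv ▷ Y ≫ t ▷ Y ≫ (λ_ Y).hom) h
  simpa [contractLeft] using this

lemma whiskerLeft_unit_contractRight {A : C} {κ : A ⊗ A ⟶ 𝟙_ C} {u : 𝟙_ C ⟶ A} {e : A ⟶ 𝟙_ C}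
    (h : A ◁ u ≫ κ = (ρ_ A).hom ≫ e) (Y : C) :
    (ρ_ _).inv ≫ (Y ⊗ A) ◁ u ≫ contractRight κ Y = Y ◁ e ≫ (ρ_ Y).hom := by
  have := congrArg (fun t => Y ◁ (ρ_ A).inv ≫ Y ◁ t ≫ (ρ_ Y).hom) h
  simpa [contractRight] using this

lemma unit_whiskerRight_contractRight {A : C} {κ : A ⊗ A ⟶ 𝟙_ C} {u : 𝟙_ C ⟶ A} {e : A ⟶ 𝟙_ C}
    (h : u ▷ A ≫ κ = (λ_ A).hom ≫ e) (Y : C) :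
    ((ρ_ Y).inv ≫ Y ◁ u) ▷ A ≫ contractRight κ Y = Y ◁ e ≫ (ρ_ Y).hom := by
  have := congrArg (fun t => Y ◁ (λ_ A).inv ≫ Y ◁ t ≫ (ρ_ Y).hom) h
  simpa [contractRight] using this

lemma contractRight_tensor {A : C} (κ : A ⊗ A ⟶ 𝟙_ C) (Y Z : C) :
    (α_ Y Z A).inv ▷ A ≫ contractRight κ (Y ⊗ Z) =
      (α_ Y (Z ⊗ A) A).hom ≫ Y ◁ contractRight κ Z := by
  simp [contractRight]

variable {u : 𝟙_ C ⟶ T.obj (𝟙_ C)} {κ : T.obj (𝟙_ C) ⊗ T.obj (𝟙_ C) ⟶ 𝟙_ C}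

namespace IsFrobeniusPairing

lemma contractLeft_hom (h : T.IsFrobeniusPairing u κ) {Y : C} (y : T.obj Y ⟶ Y) :
    T.map (contractLeft κ Y) ≫ y =
      T.tensorAction (T.mul (𝟙_ C)) (T.tensorAction (T.mul (𝟙_ C)) y) ≫ contractLeft κ Y := by
  have hα := T.tensorAction_associator (T.mul (𝟙_ C)) (T.mul (𝟙_ C)) y
  rw [← Iso.comp_inv_eq, Category.assoc] at hα
  simp only [contractLeft, T.map_comp, Category.assoc]
  rw [T.tensorAction_leftUnitor, reassoc_of% (T.tensorAction_nat_left y h.pairing_hom),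
    ← reassoc_of% hα,
    ← T.map_comp_assoc]
  simp

lemma contractRight_hom (h : T.IsFrobeniusPairing u κ) {Y : C} (y : T.obj Y ⟶ Y) :
    T.map (contractRight κ Y) ≫ y =
      T.tensorAction (T.tensorAction y (T.mul (𝟙_ C))) (T.mul (𝟙_ C)) ≫ contractRight κ Y := by
  simp only [contractRight, T.map_comp, Category.assoc]
  rw [T.tensorAction_rightUnitor, reassoc_of% (T.tensorAction_nat_right y h.pairing_hom),
    reassoc_of% (@tensorAction_associator _ _ _ T _)]

variable [T.IsComonoidal]

/-- The Frobenius structure of the comonad `T𝟙 ⊗ -`, with unit `u ⊗ Y` and pairing `contractLeft`,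
is transported to `FU` along the comonad isomorphism `toUnitTensor`. -/
lemma exists_forgetFreeAdj_left (h : T.IsFrobeniusPairing u κ) (hT : T.IsOfDescentType)
    (hiso : ∀ {Y : C} (y : T.obj Y ⟶ Y), T.IsAction y → IsIso (T.toUnitTensor y)) :
    ∃ a : T.ForgetFreeAdj, ∀ X : C, T.map (a.n X) =
      T.map (T.map (T.one X)) ≫ T.toUnitTensor (T.mul (T.obj X)) ≫
        T.obj (𝟙_ C) ◁ T.toUnitTensor (T.mul X) ≫ contractLeft κ (T.obj X) := by
  have k_hom : ∀ {Y : C} (y : T.obj Y ⟶ Y), T.IsAction y →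
      T.map (T.toUnitTensor (T.mul Y) ≫ T.obj (𝟙_ C) ◁ T.toUnitTensor y ≫ contractLeft κ Y) ≫ y =
        T.mul (T.obj Y) ≫
          T.toUnitTensor (T.mul Y) ≫ T.obj (𝟙_ C) ◁ T.toUnitTensor y ≫ contractLeft κ Y := by
    intro Y y hy
    simp only [T.map_comp, Category.assoc]
    rw [h.contractLeft_hom, reassoc_of% (T.tensorAction_nat_right _ (toUnitTensor_hom hy)),
      reassoc_of% (toUnitTensor_hom (T.isAction_mul Y))]
  have w_hom : ∀ {Y : C} (y : T.obj Y ⟶ Y) (hy : T.IsAction y),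
      letI := hiso y hy
      T.map ((λ_ Y).inv ≫ u ▷ Y ≫ inv (T.toUnitTensor y)) ≫ T.mul Y =
        y ≫ (λ_ Y).inv ≫ u ▷ Y ≫ inv (T.toUnitTensor y) := by
    intro Y y hy
    have := hiso y hy
    rw [← cancel_mono (T.toUnitTensor y)]
    simp only [Category.assoc, IsIso.inv_hom_id, Category.comp_id, ← toUnitTensor_hom hy]
    rw [← T.map_comp_assoc]
    simp only [Category.assoc, IsIso.inv_hom_id, Category.comp_id]
    rw [T.map_comp, Category.assoc, T.tensorAction_nat_left y h.unit_hom]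
    have := T.tensorAction_leftUnitor y
    rw [← Iso.comp_inv_eq, Category.assoc] at this
    rw [← reassoc_of% this, ← T.map_comp_assoc, Iso.inv_hom_id, T.map_id, Category.id_comp]
  refine hT.exists_forgetFreeAdj
    (k := fun {Y} y =>
      T.toUnitTensor (T.mul Y) ≫ T.obj (𝟙_ C) ◁ T.toUnitTensor y ≫ contractLeft κ Y)
    (w := fun {Y} y hy => letI := hiso y hy; (λ_ Y).inv ≫ u ▷ Y ≫ inv (T.toUnitTensor y))
    k_hom ?_ ?_ ?_ ?_ ?_ ?_
  · intro Y Z y z f hf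
    rw [reassoc_of% (T.toUnitTensor_nat (T.mul_nat f)), ← MonoidalCategory.whiskerLeft_comp_assoc,
      T.toUnitTensor_nat hf, MonoidalCategory.whiskerLeft_comp_assoc, contractLeft_nat]
    simp only [Category.assoc]
  · exact w_hom
  · intro Y Z y hy z hz f hf
    have := hiso y hy
    have := hiso z hz
    rw [← cancel_mono (T.toUnitTensor z)]
    simp only [Category.assoc, IsIso.inv_hom_id, Category.comp_id, T.toUnitTensor_nat hf,
      IsIso.inv_hom_id_assoc]
    rw [← whisker_exchange, leftUnitor_inv_naturality_assoc]
  -- The Frobenius law of `FU`: after `toUnitTensor`, both sides are governed by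
  -- `toUnitTensor_comul` and differ by `comul_contractLeft`.
  · intro Y y hy
    have := hiso y hy
    rw [← cancel_mono (T.toUnitTensor y), Category.assoc, T.toUnitTensor_nat (k_hom y hy)]
    simp only [MonoidalCategory.whiskerLeft_comp, Category.assoc]
    rw [reassoc_of% (@toUnitTensor_comul _ _ _ T _), ← contractLeft_nat,
      reassoc_of% (T.toUnitTensor_nat (T.mul_nat (T.one Y))),
      ← MonoidalCategory.whiskerLeft_comp_assoc, ← MonoidalCategory.whiskerLeft_comp_assoc,
      Category.assoc, T.toUnitTensor_comul, MonoidalCategory.whiskerLeft_comp_assoc,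
      ← comul_contractLeft h.comul, whisker_exchange_assoc]
    simp
  · intro Y y hy
    have := hiso _ (T.isAction_mul Y)
    simp only [Category.assoc, IsIso.inv_hom_id_assoc]
    rw [← whisker_exchange_assoc, ← leftUnitor_inv_naturality_assoc,
      unit_whiskerRight_contractLeft h.unit_left, toUnitTensor_counit]
  · intro Y y hy
    have := hiso y hy
    rw [reassoc_of% (T.toUnitTensor_nat (w_hom y hy)), ← MonoidalCategory.whiskerLeft_comp_assoc]
    simp only [Category.assoc, IsIso.inv_hom_id, Category.comp_id]
    rw [whiskerLeft_unit_contractLeft h.unit_right, toUnitTensor_counit]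

/-- The mirror argument for `- ⊗ T𝟙`. The adjunction it gives is not claimed to agree with the one
from `T𝟙 ⊗ -`. -/
lemma exists_forgetFreeAdj_right (h : T.IsFrobeniusPairing u κ) (hT : T.IsOfDescentType)
    (hiso : ∀ {Y : C} (y : T.obj Y ⟶ Y), T.IsAction y → IsIso (T.toTensorUnit y)) :
    ∃ a : T.ForgetFreeAdj, ∀ X : C, T.map (a.n X) =
      T.map (T.map (T.one X)) ≫ T.toTensorUnit (T.mul (T.obj X)) ≫
        T.toTensorUnit (T.mul X) ▷ T.obj (𝟙_ C) ≫ contractRight κ (T.obj X) := by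
  have k_hom : ∀ {Y : C} (y : T.obj Y ⟶ Y), T.IsAction y →
      T.map (T.toTensorUnit (T.mul Y) ≫ T.toTensorUnit y ▷ T.obj (𝟙_ C) ≫ contractRight κ Y) ≫ y =
        T.mul (T.obj Y) ≫
          T.toTensorUnit (T.mul Y) ≫ T.toTensorUnit y ▷ T.obj (𝟙_ C) ≫ contractRight κ Y := by
    intro Y y hy
    simp only [T.map_comp, Category.assoc]
    rw [h.contractRight_hom, reassoc_of% (T.tensorAction_nat_left _ (toTensorUnit_hom hy)),
      reassoc_of% (toTensorUnit_hom (T.isAction_mul Y))]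
  have w_hom : ∀ {Y : C} (y : T.obj Y ⟶ Y) (hy : T.IsAction y),
      letI := hiso y hy
      T.map ((ρ_ Y).inv ≫ Y ◁ u ≫ inv (T.toTensorUnit y)) ≫ T.mul Y =
        y ≫ (ρ_ Y).inv ≫ Y ◁ u ≫ inv (T.toTensorUnit y) := by
    intro Y y hy
    have := hiso y hy
    rw [← cancel_mono (T.toTensorUnit y)]
    simp only [Category.assoc, IsIso.inv_hom_id, Category.comp_id, ← toTensorUnit_hom hy]
    rw [← T.map_comp_assoc]
    simp only [Category.assoc, IsIso.inv_hom_id, Category.comp_id]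
    rw [T.map_comp, Category.assoc, T.tensorAction_nat_right y h.unit_hom]
    have := T.tensorAction_rightUnitor y
    rw [← Iso.comp_inv_eq, Category.assoc] at this
    rw [← reassoc_of% this, ← T.map_comp_assoc, Iso.inv_hom_id, T.map_id, Category.id_comp]
  refine hT.exists_forgetFreeAdj
    (k := fun {Y} y =>
      T.toTensorUnit (T.mul Y) ≫ T.toTensorUnit y ▷ T.obj (𝟙_ C) ≫ contractRight κ Y)
    (w := fun {Y} y hy => letI := hiso y hy; (ρ_ Y).inv ≫ Y ◁ u ≫ inv (T.toTensorUnit y))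
    k_hom ?_ ?_ ?_ ?_ ?_ ?_
  · intro Y Z y z f hf
    rw [reassoc_of% (T.toTensorUnit_nat (T.mul_nat f)), ← comp_whiskerRight_assoc,
      T.toTensorUnit_nat hf, comp_whiskerRight_assoc, contractRight_nat]
    simp only [Category.assoc]
  · exact w_hom
  · intro Y Z y hy z hz f hf
    have := hiso y hy
    have := hiso z hz
    rw [← cancel_mono (T.toTensorUnit z)]
    simp only [Category.assoc, IsIso.inv_hom_id, Category.comp_id, T.toTensorUnit_nat hf,
      IsIso.inv_hom_id_assoc]
    rw [whisker_exchange, rightUnitor_inv_naturality_assoc]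
  · intro Y y hy
    have := hiso y hy
    rw [← cancel_mono (T.toTensorUnit y), Category.assoc, T.toTensorUnit_nat (k_hom y hy)]
    simp only [comp_whiskerRight, Category.assoc]
    rw [reassoc_of% (@toTensorUnit_comul _ _ _ T _), ← contractRight_nat,
      reassoc_of% (T.toTensorUnit_nat (T.mul_nat (T.one Y))),
      ← comp_whiskerRight_assoc, ← comp_whiskerRight_assoc,
      Category.assoc, T.toTensorUnit_comul, comp_whiskerRight_assoc,
      ← comul_contractRight h.comul, ← whisker_exchange_assoc]
    simp
  · intro Y y hy
    have := hiso _ (T.isAction_mul Y)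
    simp only [Category.assoc, IsIso.inv_hom_id_assoc]
    rw [whisker_exchange_assoc, ← rightUnitor_inv_naturality_assoc,
      whiskerLeft_unit_contractRight h.unit_right, toTensorUnit_counit]
  · intro Y y hy
    have := hiso y hy
    rw [reassoc_of% (T.toTensorUnit_nat (w_hom y hy)), ← comp_whiskerRight_assoc]
    simp only [Category.assoc, IsIso.inv_hom_id, Category.comp_id]
    rw [unit_whiskerRight_contractRight h.unit_left, toTensorUnit_counit]

end IsFrobeniusPairing

/-- For the adjunction that the pairing `κ` on the left of `T𝟙 ⊗ Y` gives, the counit `n` of a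
tensor product with an algebra is computed on the first factor. -/
lemma fusionLeft_n [T.IsComonoidal] (hT : T.IsOfDescentType) {a : T.ForgetFreeAdj}
    (ha : ∀ X : C, T.map (a.n X) =
      T.map (T.map (T.one X)) ≫ T.toUnitTensor (T.mul (T.obj X)) ≫
        T.obj (𝟙_ C) ◁ T.toUnitTensor (T.mul X) ≫ contractLeft κ (T.obj X))
    (X : C) {Y : C} {y : T.obj Y ⟶ Y} (hy : T.IsAction y) [IsIso (T.fusionLeft X y)] :
    T.fusionLeft X y ≫ a.n X ▷ Y = a.n (X ⊗ Y) := by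
  have ha' (X : C) : T.map (a.n X) = T.toUnitTensor (T.mul X) ≫
      T.obj (𝟙_ C) ◁ (T.map (T.one X) ≫ T.toUnitTensor (T.mul X)) ≫
        contractLeft κ (T.obj X) := by
    rw [ha, reassoc_of% (T.toUnitTensor_nat (T.mul_nat (T.one X))),
      MonoidalCategory.whiskerLeft_comp_assoc]
  -- Fusion carries the coaction on the free algebra on `X ⊗ Y` to the coaction on `TX`, tensored
  -- with `Y`.
  have hs : (T.map (T.one (X ⊗ Y)) ≫ T.toUnitTensor (T.mul (X ⊗ Y))) ≫
      T.obj (𝟙_ C) ◁ T.fusionLeft X y =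
      T.fusionLeft X y ≫ (T.map (T.one X) ≫ T.toUnitTensor (T.mul X)) ▷ Y ≫ (α_ _ _ _).hom := by
    rw [Category.assoc, ← T.toUnitTensor_nat (fusionLeft_hom X hy), toUnitTensor_tensorAction,
      ← T.map_comp_assoc, one_fusionLeft X hy, reassoc_of% (@fusionLeft_nat_left _ _ _ T _),
      comp_whiskerRight_assoc]
  -- After `T`, both counits are contractions of `T𝟙` factors on the far left, where `Y` is a
  -- bystander.
  apply hT.map_injective
  rw [← cancel_mono (T.fusionLeft X y), T.map_comp, Category.assoc, fusionLeft_nat_left, ha', ha',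
    Category.assoc, Category.assoc, ← contractLeft_nat, ← MonoidalCategory.whiskerLeft_comp_assoc,
    hs]
  simp only [MonoidalCategory.whiskerLeft_comp, comp_whiskerRight, Category.assoc]
  rw [contractLeft_tensor, ← reassoc_of% (T.toUnitTensor_nat (fusionLeft_hom X hy)),
    toUnitTensor_tensorAction]
  simp

lemma fusionRight_n [T.IsComonoidal] (hT : T.IsOfDescentType) {a : T.ForgetFreeAdj}
    (ha : ∀ X : C, T.map (a.n X) =
      T.map (T.map (T.one X)) ≫ T.toTensorUnit (T.mul (T.obj X)) ≫
        T.toTensorUnit (T.mul X) ▷ T.obj (𝟙_ C) ≫ contractRight κ (T.obj X))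
    {Y : C} {y : T.obj Y ⟶ Y} (hy : T.IsAction y) (X : C) [IsIso (T.fusionRight y X)] :
    T.fusionRight y X ≫ Y ◁ a.n X = a.n (Y ⊗ X) := by
  have ha' (X : C) : T.map (a.n X) = T.toTensorUnit (T.mul X) ≫
      (T.map (T.one X) ≫ T.toTensorUnit (T.mul X)) ▷ T.obj (𝟙_ C) ≫
        contractRight κ (T.obj X) := by
    rw [ha, reassoc_of% (T.toTensorUnit_nat (T.mul_nat (T.one X))), comp_whiskerRight_assoc]
  have hs : (T.map (T.one (Y ⊗ X)) ≫ T.toTensorUnit (T.mul (Y ⊗ X))) ≫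
      T.fusionRight y X ▷ T.obj (𝟙_ C) =
      T.fusionRight y X ≫ Y ◁ (T.map (T.one X) ≫ T.toTensorUnit (T.mul X)) ≫ (α_ _ _ _).inv := by
    rw [Category.assoc, ← T.toTensorUnit_nat (fusionRight_hom hy X), toTensorUnit_tensorAction,
      ← T.map_comp_assoc, one_fusionRight hy X, reassoc_of% (@fusionRight_nat_right _ _ _ T _),
      MonoidalCategory.whiskerLeft_comp_assoc]
  apply hT.map_injective
  rw [← cancel_mono (T.fusionRight y X), T.map_comp, Category.assoc, fusionRight_nat_right, ha',
    ha', Category.assoc, Category.assoc, ← contractRight_nat, ← comp_whiskerRight_assoc, hs]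
  simp only [MonoidalCategory.whiskerLeft_comp, comp_whiskerRight, Category.assoc]
  rw [contractRight_tensor, ← reassoc_of% (T.toTensorUnit_nat (fusionRight_hom hy X)),
    toTensorUnit_tensorAction]
  simp

end Pairing

end Monad

/-- Spells out monoidality with the lax structures of the identity and of `G` composed with itself
unfolded. -/
lemma Comonad.IsHopf.of_components {C : Type u} [Category.{v} C] [MonoidalCategory C]
    (G : Comonad C) [G.toFunctor.LaxMonoidal]
    (h₁ : LaxMonoidal.ε G.toFunctor ≫ G.ε.app (𝟙_ C) = 𝟙 (𝟙_ C))
    (h₂ : ∀ X Y : C, μ G.toFunctor X Y ≫ G.ε.app (X ⊗ Y) = (G.ε.app X ⊗ₘ G.ε.app Y))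
    (h₃ : LaxMonoidal.ε G.toFunctor ≫ G.δ.app (𝟙_ C) =
      LaxMonoidal.ε G.toFunctor ≫ G.map (LaxMonoidal.ε G.toFunctor))
    (h₄ : ∀ X Y : C, μ G.toFunctor X Y ≫ G.δ.app (X ⊗ Y) =
      (G.δ.app X ⊗ₘ G.δ.app Y) ≫ μ G.toFunctor (G.obj X) (G.obj Y) ≫ G.map (μ G.toFunctor X Y))
    (h₅ : ∀ X Y : C, IsIso (G.leftFusion X Y)) (h₆ : ∀ X Y : C, IsIso (G.rightFusion X Y)) :
    G.IsHopf where
  counit_isMonoidal := ⟨h₁, fun X Y => (h₂ X Y).trans (Category.comp_id _).symm⟩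
  comul_isMonoidal := ⟨h₃, h₄⟩
  isIso_leftFusion := h₅
  isIso_rightFusion := h₆

namespace Monad

namespace ForgetFreeAdj

/-! ### The self-adjunction of `T` and its Frobenius monad -/

section Plain

variable {C : Type u} [Category.{v} C] {T : Monad C} (a : T.ForgetFreeAdj)

/-- The comultiplication `TX ⟶ TTX`. -/
def comul (X : C) : T.obj X ⟶ T.obj (T.obj X) := a.w (T.mul X) (T.isAction_mul X)

lemma comul_n (X : C) : a.comul X ≫ a.n (T.obj X) = 𝟙 _ := a.w_n _ _

lemma comul_map_n (X : C) : a.comul X ≫ T.map (a.n X) = 𝟙 _ := a.w_map_n X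

lemma comul_hom (X : C) : T.map (a.comul X) ≫ T.mul (T.obj X) = T.mul X ≫ a.comul X := a.w_hom _ _

lemma comul_mul (X : C) : a.comul (T.obj X) ≫ T.map (T.mul X) = T.mul X ≫ a.comul X :=
  a.w_nat _ _ _ _ _ (T.mul_assoc X)

lemma comul_nat {X Y : C} (f : X ⟶ Y) :
    a.comul X ≫ T.map (T.map f) = T.map f ≫ a.comul Y :=
  a.w_nat _ _ _ _ _ (T.mul_nat f)

/-- The composite adjunction `T = UF ⊣ UF = T`. -/
def selfAdjunction : T.toFunctor ⊣ T.toFunctor :=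
  Adjunction.mkOfUnitCounit
    { unit :=
        { app X := T.one X ≫ a.comul X
          naturality X Y f := by
            change f ≫ T.one Y ≫ a.comul Y = (T.one X ≫ a.comul X) ≫ T.map (T.map f)
            rw [Category.assoc, comul_nat, reassoc_of% (@one_nat _ _ T)] }
      counit :=
        { app X := T.mul X ≫ a.n X
          naturality X Y f := by
            change T.map (T.map f) ≫ T.mul Y ≫ a.n Y = (T.mul X ≫ a.n X) ≫ f
            rw [Category.assoc, reassoc_of% (@mul_nat _ _ T), a.n_nat] }
      left_triangle := by
        ext X
        change T.map (T.one X ≫ a.comul X) ≫ 𝟙 _ ≫ T.mul (T.obj X) ≫ a.n (T.obj X) = 𝟙 _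
        rw [T.map_comp, Category.id_comp, Category.assoc, reassoc_of% a.comul_hom,
          reassoc_of% T.map_one_mul,
          comul_n]
      right_triangle := by
        ext X
        change (T.one (T.obj X) ≫ a.comul (T.obj X)) ≫ 𝟙 _ ≫ T.map (T.mul X ≫ a.n X) = 𝟙 _
        rw [T.map_comp, Category.id_comp, Category.assoc, reassoc_of% a.comul_mul,
          reassoc_of% T.one_mul,
          comul_map_n] }

lemma adjointComonad_ε_app (X : C) : (T.adjointComonad a.selfAdjunction).ε.app X = a.n X := by
  rw [adjointComonad_ε, conjugate_unit_app]
  change T.one (T.obj X) ≫ T.mul X ≫ a.n X = a.n X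
  rw [reassoc_of% T.one_mul]

/-- A mate is determined by its double transpose, so it suffices that `a.comul X` satisfies the
equation `conjugate_mul_counit`. -/
lemma adjointComonad_δ_app (X : C) : (T.adjointComonad a.selfAdjunction).δ.app X = a.comul X := by
  rw [adjointComonad_δ]
  have h := T.conjugate_mul_counit a.selfAdjunction X
  generalize (conjugateEquiv a.selfAdjunction (a.selfAdjunction.comp a.selfAdjunction) T.μ).app X
    = d at h ⊢
  change T.obj X ⟶ T.obj (T.obj X) at d
  change T.map (T.map d) ≫ T.map (T.mul (T.obj X) ≫ a.n (T.obj X)) ≫ T.mul X ≫ a.n X =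
    T.mul (T.obj X) ≫ T.mul X ≫ a.n X at h
  have key : T.map (T.map (a.comul X)) ≫ T.map (T.mul (T.obj X) ≫ a.n (T.obj X)) ≫
      T.mul X ≫ a.n X = T.mul (T.obj X) ≫ T.mul X ≫ a.n X := by
    rw [← T.map_comp_assoc, reassoc_of% a.comul_hom, comul_n, Category.comp_id,
      reassoc_of% T.mul_assoc]
  have inj : ∀ {Y Z : C} {f g : Y ⟶ T.obj Z},
      T.map f ≫ T.mul Z ≫ a.n Z = T.map g ≫ T.mul Z ≫ a.n Z → f = g := by
    intro Y Z f g hfg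
    apply (a.selfAdjunction.homEquiv _ _).symm.injective
    rw [Adjunction.homEquiv_counit, Adjunction.homEquiv_counit]
    exact hfg
  apply inj
  apply inj
  simp only [T.map_comp, Category.assoc] at h key ⊢
  exact h.trans key.symm

/-- The two Frobenius laws are naturality of `w` at the algebra morphism `T.mul X` (`comul_mul`),
and the fact that `w` is itself a morphism of algebras (`comul_hom`). -/
lemma isFrobenius_selfAdjunction :
    T.IsFrobenius (T.adjointComonad a.selfAdjunction).comonObj := by
  unfold IsFrobenius
  refine @IsFrobeniusMonoid.mk (C ⥤ C) _ (endofunctorMonoidalCategory C) _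
    (T.adjointComonad a.selfAdjunction).comonObj _ _ ?_ ?_ ?_ ?_
  · ext X
    exact T.right_unit X
  · ext X
    exact T.left_unit X
  · ext X
    have h := a.adjointComonad_δ_app X
    have h' := a.adjointComonad_δ_app (T.obj X)
    change (T.adjointComonad a.selfAdjunction).δ.app (T.obj X) ≫ 𝟙 _ ≫ T.map (T.mul X) =
      T.mul X ≫ (T.adjointComonad a.selfAdjunction).δ.app X
    rw [h, h']
    exact (congrArg (a.comul (T.obj X) ≫ ·) (Category.id_comp _)).trans (a.comul_mul X)
  · ext X
    have h := a.adjointComonad_δ_app X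
    change T.map ((T.adjointComonad a.selfAdjunction).δ.app X) ≫ 𝟙 _ ≫ T.mul (T.obj X) =
      T.mul X ≫ (T.adjointComonad a.selfAdjunction).δ.app X
    rw [h]
    exact (congrArg (T.map (a.comul X) ≫ ·) (Category.id_comp _)).trans (a.comul_hom X)

end Plain

/-! ### The monoidal structure of the right adjoint, cofusion and the Frobenius monoidal laws -/

section Monoidal

variable {C : Type u} [Category.{v} C] [MonoidalCategory C] {T : Monad C}
  [T.toFunctor.OplaxMonoidal] [T.IsComonoidal] (a b : T.ForgetFreeAdj)

/-- The unit of the adjunction at the tensor product of two algebras. -/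
def wTensor {Y Z : C} {y : T.obj Y ⟶ Y} {z : T.obj Z ⟶ Z} (hy : T.IsAction y)
    (hz : T.IsAction z) : Y ⊗ Z ⟶ T.obj (Y ⊗ Z) :=
  a.w (T.tensorAction y z) (hy.tensor hz)

lemma wTensor_n {Y Z : C} {y : T.obj Y ⟶ Y} {z : T.obj Z ⟶ Z} (hy : T.IsAction y)
    (hz : T.IsAction z) : a.wTensor hy hz ≫ a.n (Y ⊗ Z) = 𝟙 _ := a.w_n _ _

lemma wTensor_nat {X Y X' Y' : C} {x : T.obj X ⟶ X} {y : T.obj Y ⟶ Y} {x' : T.obj X' ⟶ X'}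
    {y' : T.obj Y' ⟶ Y'} (hx : T.IsAction x) (hy : T.IsAction y) (hx' : T.IsAction x')
    (hy' : T.IsAction y') {f : X ⟶ X'} {g : Y ⟶ Y'} (hf : T.map f ≫ x' = x ≫ f)
    (hg : T.map g ≫ y' = y ≫ g) :
    a.wTensor hx hy ≫ T.map (f ⊗ₘ g) = (f ⊗ₘ g) ≫ a.wTensor hx' hy' :=
  a.w_nat _ _ _ _ _ (T.tensorAction_nat hf hg)

lemma wTensor_nat_left {X Y X' : C} {x : T.obj X ⟶ X} {y : T.obj Y ⟶ Y} {x' : T.obj X' ⟶ X'}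
    (hx : T.IsAction x) (hy : T.IsAction y) (hx' : T.IsAction x')
    {f : X ⟶ X'} (hf : T.map f ≫ x' = x ≫ f) :
    a.wTensor hx hy ≫ T.map (f ▷ Y) = f ▷ Y ≫ a.wTensor hx' hy :=
  a.w_nat _ _ _ _ _ (T.tensorAction_nat_left y hf)

lemma wTensor_nat_right {X Y Y' : C} {x : T.obj X ⟶ X} {y : T.obj Y ⟶ Y} {y' : T.obj Y' ⟶ Y'}
    (hx : T.IsAction x) (hy : T.IsAction y) (hy' : T.IsAction y')
    {f : Y ⟶ Y'} (hf : T.map f ≫ y' = y ≫ f) :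
    a.wTensor hx hy ≫ T.map (X ◁ f) = X ◁ f ≫ a.wTensor hx hy' :=
  a.w_nat _ _ _ _ _ (T.tensorAction_nat_right x hf)

/-- The monoidal structure `TX ⊗ TY ⟶ T(X ⊗ Y)`. -/
def lax (X Y : C) : T.obj X ⊗ T.obj Y ⟶ T.obj (X ⊗ Y) :=
  a.wTensor (T.isAction_mul X) (T.isAction_mul Y) ≫ T.map (a.n X ⊗ₘ a.n Y)

lemma lax_hom (X Y : C) : T.map (a.lax X Y) ≫ T.mul (X ⊗ Y) =
    T.tensorAction (T.mul X) (T.mul Y) ≫ a.lax X Y := by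
  rw [lax, T.map_comp, Category.assoc, mul_nat, wTensor, ← Category.assoc, a.w_hom, Category.assoc]

lemma lax_n (X Y : C) : a.lax X Y ≫ a.n (X ⊗ Y) = (a.n X ⊗ₘ a.n Y) := by
  rw [lax, Category.assoc, a.n_nat, reassoc_of% (@wTensor_n _ _ _ T _ _ a)]

lemma lax_comul (X Y : C) : a.lax X Y ≫ a.comul (X ⊗ Y) =
    (a.comul X ⊗ₘ a.comul Y) ≫ a.lax (T.obj X) (T.obj Y) ≫ T.map (a.lax X Y) := by
  have h := a.w_nat _ ((T.isAction_mul X).tensor (T.isAction_mul Y)) _ (T.isAction_mul _) _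
    (a.lax_hom X Y)
  rw [comul, ← h, lax, lax, Category.assoc, ← reassoc_of% (a.wTensor_nat (T.isAction_mul X)
    (T.isAction_mul Y) _ _ (a.comul_hom X) (a.comul_hom Y)), ← T.map_comp_assoc,
    tensorHom_comp_tensorHom, comul_n, comul_n, id_tensorHom_id, T.map_id, Category.id_comp]
  rfl

/-- Naturality of `w` moves the comultiplication inside `T`, where it cancels the counit on the
second factor. -/
lemma comul_lax_left (X Y : C) : T.obj X ◁ a.comul Y ≫ a.lax X (T.obj Y) =
    a.wTensor (T.isAction_mul X) (T.isAction_mul Y) ≫ T.map (a.n X ▷ T.obj Y) := by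
  rw [lax,
    ← reassoc_of% (a.wTensor_nat_right (T.isAction_mul X) (T.isAction_mul Y) _ (a.comul_hom Y)),
    ← T.map_comp, tensorHom_def', ← MonoidalCategory.whiskerLeft_comp_assoc, comul_n,
    MonoidalCategory.whiskerLeft_id, Category.id_comp]

lemma comul_lax_right (X Y : C) : a.comul X ▷ T.obj Y ≫ a.lax (T.obj X) Y =
    a.wTensor (T.isAction_mul X) (T.isAction_mul Y) ≫ T.map (T.obj X ◁ a.n Y) := by
  rw [lax,
    ← reassoc_of% (a.wTensor_nat_left (T.isAction_mul X) (T.isAction_mul Y) _ (a.comul_hom X)),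
    ← T.map_comp, MonoidalCategory.tensorHom_def, ← comp_whiskerRight_assoc, comul_n,
    id_whiskerRight, Category.id_comp]

/-- The counit of the adjunction is compatible with tensoring with an algebra on the right. -/
def IsLeftCompatible : Prop :=
  ∀ (X : C) {Y : C} {y : T.obj Y ⟶ Y}, T.IsAction y → T.fusionLeft X y ≫ a.n X ▷ Y = a.n (X ⊗ Y)

/-- The counit of the adjunction is compatible with tensoring with an algebra on the left. -/
def IsRightCompatible : Prop :=
  ∀ {Y : C} {y : T.obj Y ⟶ Y} (X : C), T.IsAction y → T.fusionRight y X ≫ Y ◁ a.n X = a.n (Y ⊗ X)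

variable {a b}

/-- Naturality of `w` along fusion, together with compatibility, reduces the composite to a triangle
identity. By `comul_lax_left`, the second factor is the left cofusion operator when `y` is free. -/
lemma IsLeftCompatible.fusionLeft_wTensor (h : a.IsLeftCompatible) (X : C) {Y : C}
    {y : T.obj Y ⟶ Y} (hy : T.IsAction y) :
    T.fusionLeft X y ≫ a.wTensor (T.isAction_mul X) hy ≫ T.map (a.n X ▷ Y) = 𝟙 _ := by
  rw [wTensor, ← Category.assoc, ← a.w_nat _ (T.isAction_mul _) _ _ _ (fusionLeft_hom X hy),
    Category.assoc, ← T.map_comp, h X hy, a.w_map_n]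

lemma IsRightCompatible.fusionRight_wTensor (h : a.IsRightCompatible) {Y : C}
    {y : T.obj Y ⟶ Y} (hy : T.IsAction y) (X : C) :
    T.fusionRight y X ≫ a.wTensor hy (T.isAction_mul X) ≫ T.map (Y ◁ a.n X) = 𝟙 _ := by
  rw [wTensor, ← Category.assoc, ← a.w_nat _ (T.isAction_mul _) _ _ _ (fusionRight_hom hy X),
    Category.assoc, ← T.map_comp, h X hy, a.w_map_n]

lemma IsLeftCompatible.isIso_comul_lax (h : a.IsLeftCompatible) (X Y : C)
    [IsIso (T.fusionLeft X (T.mul Y))] : IsIso (T.obj X ◁ a.comul Y ≫ a.lax X (T.obj Y)) := by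
  rw [comul_lax_left, IsIso.eq_inv_of_hom_inv_id (h.fusionLeft_wTensor X (T.isAction_mul Y))]
  infer_instance

/-- The right cofusion operators of `a` are invertible as soon as some adjunction `b` is compatible
with tensoring on the left: `a` and `b` differ by an automorphism of the free algebra functor. -/
lemma IsRightCompatible.isIso_comul_lax (h : b.IsRightCompatible) (X Y : C)
    [IsIso (T.fusionRight (T.mul X) Y)] : IsIso (a.comul X ▷ T.obj Y ≫ a.lax (T.obj X) Y) := by
  -- The right cofusion operator of `a` is that of `b` between two comparison automorphisms: the
  -- counit of `a` is that of `b` after `compare b a`, and its unit is that of `b` before `compare a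
  -- b`.
  have key : a.wTensor (T.isAction_mul X) (T.isAction_mul Y) ≫ T.map (T.obj X ◁ a.n Y) =
      T.obj X ◁ compare b a Y ≫ (b.wTensor (T.isAction_mul X) (T.isAction_mul Y) ≫
        T.map (T.obj X ◁ b.n Y)) ≫ compare a b (T.obj X ⊗ Y) := by
    rw [Category.assoc, ← reassoc_of% (b.wTensor_nat_right (T.isAction_mul X) (T.isAction_mul Y) _
      (compare_hom b a Y)), ← T.map_comp_assoc, ← MonoidalCategory.whiskerLeft_comp, compare_n,
      compare_nat, wTensor, wTensor, ← w_compare a b, Category.assoc]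
  have := isIso_compare a b (T.obj X ⊗ Y)
  have := isIso_compare b a Y
  rw [comul_lax_right, key,
    IsIso.eq_inv_of_hom_inv_id (h.fusionRight_wTensor (T.isAction_mul X) Y)]
  infer_instance

/-- As left fusion is invertible for a Hopf monad, this determines `lax` and lets it be eliminated
from the Frobenius laws. -/
lemma IsLeftCompatible.fusionLeft_lax (h : a.IsLeftCompatible) (X Y : C) :
    T.fusionLeft X (T.mul Y) ≫ a.lax X Y = T.map (X ◁ a.n Y) := by
  rw [lax, MonoidalCategory.tensorHom_def, T.map_comp,
    reassoc_of% (h.fusionLeft_wTensor X (T.isAction_mul Y))]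

lemma IsLeftCompatible.frobenius_left (h : a.IsLeftCompatible) (X Y Z : C)
    [IsIso (T.fusionLeft X (T.mul (Y ⊗ Z)))] :
    T.obj X ◁ δ T.toFunctor Y Z ≫ (α_ _ _ _).inv ≫ a.lax X Y ▷ T.obj Z =
      a.lax X (Y ⊗ Z) ≫ T.map (α_ X Y Z).inv ≫ δ T.toFunctor (X ⊗ Y) Z := by
  have hα : T.fusionLeft X (T.tensorAction (T.mul Y) (T.mul Z)) ≫ (α_ _ _ _).inv =
      T.map (α_ _ _ _).inv ≫ T.fusionLeft (X ⊗ T.obj Y) (T.mul Z) ≫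
        T.fusionLeft X (T.mul Y) ▷ T.obj Z := by
    rw [Iso.comp_inv_eq, Category.assoc, Category.assoc, ← fusionLeft_tensorAction,
      ← T.map_comp_assoc, Iso.inv_hom_id, T.map_id, Category.id_comp]
  rw [← cancel_epi (T.fusionLeft X (T.mul (Y ⊗ Z))), reassoc_of% h.fusionLeft_lax,
    ← reassoc_of% (T.fusionLeft_nat_right X (mul_δ Y Z).symm), reassoc_of% hα, ← comp_whiskerRight,
    h.fusionLeft_lax, ← fusionLeft_nat_left,
    ← T.map_whiskerLeft_one_fusionLeft (X ⊗ Y) Z]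
  -- Once `lax` is eliminated, this is the only property of the counit needed: compatibility at a
  -- free algebra, precomposed with the unit.
  have hn : δ T.toFunctor Y Z ≫ a.n Y ▷ T.obj Z = a.n (Y ⊗ Z) ≫ Y ◁ T.one Z := by
    rw [← a.n_nat, ← h Y (T.isAction_mul Z), reassoc_of% T.map_whiskerLeft_one_fusionLeft]
  have hδ : X ◁ δ T.toFunctor Y Z ≫ (α_ _ _ _).inv ≫ (X ◁ a.n Y) ▷ T.obj Z =
      X ◁ a.n (Y ⊗ Z) ≫ (α_ _ _ _).inv ≫ (X ⊗ Y) ◁ T.one Z := by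
    rw [← associator_inv_naturality_middle, ← associator_inv_naturality_right,
      ← MonoidalCategory.whiskerLeft_comp_assoc, hn, MonoidalCategory.whiskerLeft_comp_assoc]
  simpa only [T.map_comp, Category.assoc] using
    congrArg (fun t => T.map t ≫ T.fusionLeft (X ⊗ Y) (T.mul Z)) hδ

/-- After precomposition with left fusion only coassociativity and naturality of `T_2` remain. -/
lemma IsLeftCompatible.frobenius_right (h : a.IsLeftCompatible) (X Y Z : C)
    [IsIso (T.fusionLeft (X ⊗ Y) (T.mul Z))] :
    δ T.toFunctor X Y ▷ T.obj Z ≫ (α_ _ _ _).hom ≫ T.obj X ◁ a.lax Y Z =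
      a.lax (X ⊗ Y) Z ≫ T.map (α_ X Y Z).hom ≫ δ T.toFunctor X (Y ⊗ Z) := by
  have hα : T.fusionLeft (X ⊗ Y) (T.mul Z) ≫ δ T.toFunctor X Y ▷ T.obj Z ≫ (α_ _ _ _).hom =
      T.map (α_ _ _ _).hom ≫ δ T.toFunctor X (Y ⊗ T.obj Z) ≫
        T.obj X ◁ T.fusionLeft Y (T.mul Z) := by
    simp only [fusionLeft, MonoidalCategory.whiskerLeft_comp, Category.assoc]
    rw [← OplaxMonoidal.associativity_assoc, whisker_exchange_assoc, tensor_whiskerLeft]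
    simp
  rw [← cancel_epi (T.fusionLeft (X ⊗ Y) (T.mul Z)), reassoc_of% h.fusionLeft_lax, reassoc_of% hα,
    ← MonoidalCategory.whiskerLeft_comp, h.fusionLeft_lax, δ_natural_right, ← T.map_comp_assoc,
    ← T.map_comp_assoc]
  simp

variable (a)

lemma rightAdjointLaxMonoidal_ε :
    letI := a.selfAdjunction.rightAdjointLaxMonoidal
    LaxMonoidal.ε T.toFunctor = a.w (OplaxMonoidal.η T.toFunctor) isAction_counit := by
  trans (T.one (𝟙_ C) ≫ a.comul (𝟙_ C)) ≫ T.map (OplaxMonoidal.η T.toFunctor)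
  · exact a.selfAdjunction.homEquiv_unit _ _ _
  rw [Category.assoc, comul, a.w_nat _ _ _ isAction_counit _ isAction_counit.assoc.symm,
    ← Category.assoc, isAction_counit.unit, Category.id_comp]

/-- The mate contains the action on `TX ⊗ TY`; `w` is natural along it, and the unit law of the
action then cancels it. -/
lemma rightAdjointLaxMonoidal_μ (X Y : C) :
    letI := a.selfAdjunction.rightAdjointLaxMonoidal
    LaxMonoidal.μ T.toFunctor X Y = a.lax X Y := by
  have h := (T.isAction_mul X).tensor (T.isAction_mul Y)
  trans (T.one _ ≫ a.comul _) ≫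
    T.map (δ T.toFunctor (T.obj X) (T.obj Y) ≫ (T.mul X ≫ a.n X ⊗ₘ T.mul Y ≫ a.n Y))
  · exact a.selfAdjunction.homEquiv_unit _ _ _
  have hw := a.w_nat _ (T.isAction_mul _) _ h _ h.assoc.symm
  rw [← tensorHom_comp_tensorHom, ← Category.assoc (δ _ _ _), T.map_comp, Category.assoc]
  change T.one _ ≫ a.w _ _ ≫ T.map (T.tensorAction (T.mul X) (T.mul Y)) ≫ _ = _
  rw [reassoc_of% hw, ← Category.assoc, h.unit, Category.id_comp]
  rfl

lemma isHopf_adjointComonad (ha : a.IsLeftCompatible) (hb : b.IsRightCompatible)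
    (hl : ∀ X Y : C, IsIso (T.fusionLeft X (T.mul Y)))
    (hr : ∀ X Y : C, IsIso (T.fusionRight (T.mul X) Y)) :
    @Comonad.IsHopf C _ _ (T.adjointComonad a.selfAdjunction)
      a.selfAdjunction.rightAdjointLaxMonoidal := by
  let _ := a.selfAdjunction.rightAdjointLaxMonoidal
  have hε := a.rightAdjointLaxMonoidal_ε
  have hμ := a.rightAdjointLaxMonoidal_μ
  have he := a.adjointComonad_ε_app
  have hd := a.adjointComonad_δ_app
  refine @Comonad.IsHopf.of_components C _ _ (T.adjointComonad a.selfAdjunction)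
    a.selfAdjunction.rightAdjointLaxMonoidal ?_ ?_ ?_ ?_ ?_ ?_
  · rw [he]
    exact (congrArg (· ≫ a.n _) hε).trans (a.w_n _ _)
  · intro X Y
    rw [he, he, he]
    exact (congrArg (· ≫ a.n _) (hμ X Y)).trans (a.lax_n X Y)
  · rw [hd]
    change LaxMonoidal.ε T.toFunctor ≫ a.comul _ =
      LaxMonoidal.ε T.toFunctor ≫ T.map (LaxMonoidal.ε T.toFunctor)
    rw [hε]
    exact (a.w_nat _ _ _ _ _ (a.w_hom _ _)).symm
  · intro X Y
    rw [hd, hd, hd]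
    change LaxMonoidal.μ T.toFunctor X Y ≫ a.comul _ = (a.comul X ⊗ₘ a.comul Y) ≫
      LaxMonoidal.μ T.toFunctor (T.obj X) (T.obj Y) ≫ T.map (LaxMonoidal.μ T.toFunctor X Y)
    rw [hμ, hμ]
    exact a.lax_comul X Y
  · intro X Y
    have := hl X Y
    have h := ha.isIso_comul_lax X Y
    rw [← hd, ← hμ] at h
    exact h
  · intro X Y
    have := hr X Y
    have h := hb.isIso_comul_lax (a := a) X Y
    rw [← hd, ← hμ] at h
    exact h

lemma isFrobeniusMonoidal_selfAdjunction (ha : a.IsLeftCompatible)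
    (hl : ∀ X Y : C, IsIso (T.fusionLeft X (T.mul Y))) :
    @Functor.IsFrobeniusMonoidal C _ _ C _ _ T.toFunctor
      a.selfAdjunction.rightAdjointLaxMonoidal _ := by
  let _ := a.selfAdjunction.rightAdjointLaxMonoidal
  refine @Functor.IsFrobeniusMonoidal.mk C _ _ C _ _ _
    a.selfAdjunction.rightAdjointLaxMonoidal _ ?_ ?_
  · intro X Y Z
    have := hl X (Y ⊗ Z)
    rw [rightAdjointLaxMonoidal_μ, rightAdjointLaxMonoidal_μ]
    exact ha.frobenius_left X Y Z
  · intro X Y Z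
    have := hl (X ⊗ Y) Z
    rw [rightAdjointLaxMonoidal_μ, rightAdjointLaxMonoidal_μ]
    exact ha.frobenius_right X Y Z

end Monoidal

end ForgetFreeAdj

/-! ### From the Frobenius monoid `T𝟙` to its pairing -/

section Main

variable {C : Type u} [Category.{v} C] [MonoidalCategory C] {T : Monad C}
  [T.toFunctor.OplaxMonoidal]

lemma comulUnit_counit_left :
    T.comulUnit ≫ OplaxMonoidal.η T.toFunctor ▷ T.obj (𝟙_ C) = (λ_ _).inv := by
  rw [comulUnit, Category.assoc, OplaxMonoidal.left_unitality]

lemma comulUnit_counit_right :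
    T.comulUnit ≫ T.obj (𝟙_ C) ◁ OplaxMonoidal.η T.toFunctor = (ρ_ _).inv := by
  rw [comulUnit, Category.assoc, OplaxMonoidal.right_unitality, unitors_inv_equal]

/-- The pairing is the multiplication followed by the counit. Each Frobenius law, followed by a
counit, recovers the multiplication from the pairing and the comultiplication. -/
lemma IsFrobeniusMonoid.isFrobeniusPairing [T.IsComonoidal]
    {u : 𝟙_ T.Algebra ⟶ T.free.obj (𝟙_ C)}
    {m : T.free.obj (𝟙_ C) ⊗ T.free.obj (𝟙_ C) ⟶ T.free.obj (𝟙_ C)}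
    (h : IsFrobeniusMonoid (T.free.obj (𝟙_ C)) u m) :
    T.IsFrobeniusPairing u.f (m.f ≫ OplaxMonoidal.η T.toFunctor) := by
  obtain ⟨u, hu⟩ := u
  obtain ⟨m, hm⟩ := m
  have h₁ := congrArg Algebra.Hom.f h.one_mul
  have h₂ := congrArg Algebra.Hom.f h.mul_one
  have h₃ := congrArg Algebra.Hom.f h.frobenius_left
  have h₄ := congrArg Algebra.Hom.f h.frobenius_right
  change 𝟙_ C ⟶ T.obj (𝟙_ C) at u
  change T.obj (𝟙_ C) ⊗ T.obj (𝟙_ C) ⟶ T.obj (𝟙_ C) at m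
  change T.map u ≫ T.mul (𝟙_ C) = OplaxMonoidal.η T.toFunctor ≫ u at hu
  change T.map m ≫ T.mul (𝟙_ C) = T.tensorAction (T.mul (𝟙_ C)) (T.mul (𝟙_ C)) ≫ m at hm
  change u ▷ T.obj (𝟙_ C) ≫ m = (λ_ _).hom at h₁
  change T.obj (𝟙_ C) ◁ u ≫ m = (ρ_ _).hom at h₂
  change T.obj (𝟙_ C) ◁ T.comulUnit ≫ (α_ _ _ _).inv ≫ m ▷ T.obj (𝟙_ C) = m ≫ T.comulUnit at h₃
  change T.comulUnit ▷ T.obj (𝟙_ C) ≫ (α_ _ _ _).hom ≫ T.obj (𝟙_ C) ◁ m = m ≫ T.comulUnit at h₄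
  change T.IsFrobeniusPairing u (m ≫ OplaxMonoidal.η T.toFunctor)
  refine ⟨hu, ?_, ?_, ?_, ?_⟩
  · have := (isAction_counit (T := T)).assoc
    rw [T.map_comp, Category.assoc, ← this, reassoc_of% hm]
  · rw [reassoc_of% h₁]
  · rw [reassoc_of% h₂]
  · rw [MonoidalCategory.whiskerLeft_comp, comp_whiskerRight, Category.assoc, Category.assoc,
      reassoc_of% h₃, reassoc_of% h₄, reassoc_of% (comulUnit_counit_left (T := T)),
      reassoc_of% (comulUnit_counit_right (T := T)), Iso.inv_hom_id, Iso.inv_hom_id]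

end Main

end Monad

end CategoryTheory

/-- `T` is a Hopf monad of descent type, and `u`, `m` make the comonoid `T𝟙` a Frobenius monoid
in the category of `T`-algebras. One self-adjunction of `T` gives all parts of the conclusion. -/
theorem mainTheorem6 {C : Type u} [Category.{v} C] [MonoidalCategory C]
    (T : CategoryTheory.Monad C) [T.toFunctor.OplaxMonoidal] [T.IsComonoidal]
    (hHopf : T.IsHopf) (hDescent : T.IsOfDescentType)
    (hFrob : ∃ (u : 𝟙_ T.Algebra ⟶ T.free.obj (𝟙_ C))
      (m : T.free.obj (𝟙_ C) ⊗ T.free.obj (𝟙_ C) ⟶ T.free.obj (𝟙_ C)),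
      IsFrobeniusMonoid (T.free.obj (𝟙_ C)) u m) :
    ∃ adj : T.toFunctor ⊣ T.toFunctor,
      T.IsBiHopf adj ∧
      T.IsFrobenius (T.adjointComonad adj).comonObj ∧
      @Functor.IsFrobeniusMonoidal C _ _ C _ _ T.toFunctor adj.rightAdjointLaxMonoidal _ := by
  obtain ⟨u, m, h⟩ := hFrob
  have hp := Monad.IsFrobeniusMonoid.isFrobeniusPairing h
  have hl : ∀ X Y : C, IsIso (T.fusionLeft X (T.mul Y)) := hHopf.isIso_leftFusion
  have hr : ∀ X Y : C, IsIso (T.fusionRight (T.mul X) Y) := hHopf.isIso_rightFusion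
  have hl' : ∀ (X : C) {Y : C} {y : T.obj Y ⟶ Y}, T.IsAction y → IsIso (T.fusionLeft X y) :=
    Monad.isIso_fusionLeft hl
  have hr' : ∀ (X : C) {Y : C} {y : T.obj Y ⟶ Y}, T.IsAction y → IsIso (T.fusionRight y X) :=
    Monad.isIso_fusionRight fun X Y => hr Y X
  obtain ⟨a, ha⟩ := hp.exists_forgetFreeAdj_left hDescent fun {Y} y hy => by
    have := hl' (𝟙_ C) hy
    unfold Monad.toUnitTensor
    infer_instance
  -- Only the right cofusion operators of `a` make use of `b`.
  obtain ⟨b, hb⟩ := hp.exists_forgetFreeAdj_right hDescent fun {Y} y hy => by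
    have := hr' (𝟙_ C) hy
    unfold Monad.toTensorUnit
    infer_instance
  have ha' : a.IsLeftCompatible := fun X _ _ hy =>
    have := hl' X hy
    Monad.fusionLeft_n hDescent ha X hy
  have hb' : b.IsRightCompatible := fun X hy =>
    have := hr' X hy
    Monad.fusionRight_n hDescent hb hy X
  exact ⟨a.selfAdjunction, ⟨hHopf, a.isHopf_adjointComonad ha' hb' hl hr⟩,
    a.isFrobenius_selfAdjunction, a.isFrobeniusMonoidal_selfAdjunction ha' hl⟩
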